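/- A \emph{pseudodiagram} (of a knot) is a generic closed curve in the plane, with one component and with finitely many transverse double points, where each double point is either a classical crossing (it is specified which branch passes over) or a \emph{precrossing} (nothing is specified). The \emph{pseudo-Reidemeister moves} are the following local changes of pseudodiagrams, together with their inverses: removing a kink whose double point is a classical crossing (R1) or a precrossing (PR1); removing a bigon with two classical crossings at which the same strand passes over (R2); exchanging, for two consecutive double points on a pair of twisted strands, $\sigma$ a classical crossing and $\tau$ a precrossing, the two factors, $\sigma\tau\leftrightarrow\tau\sigma$ (PR2); and moving a strand that passes over, or under, two other strands across the double point of these two, where this double point is a classical crossing (R3) or a precrossing (PR3). A \emph{pseudoknot} is an equivalence class of pseudodiagrams under planar isotopy and pseudo-Reidemeister moves. The \emph{unknot} is the class of the round circle, a diagram without double points. Two pseudoknots are \emph{homotopic} if they have pseudodiagrams that are related by a finite sequence of planar isotopies, pseudo-Reidemeister moves and crossing changes (a crossing change reverses the over/under information at one classical crossing). \textbf{Theorem.} Every pseudoknot that can be represented by a pseudodiagram with exactly one precrossing is homotopic to the unknot. -/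

import Mathlib

/-! Pseudodiagrams of knots in the plane, their planar isotopies, the pseudo-Reidemeister moves
and crossing changes.

A pseudodiagram is put in general position with respect to the height function of the plane and
is read from bottom to top as a finite sequence of elementary slices. Each slice contains exactly
one local minimum, one local maximum or one (pre)crossing, and vertical strands elsewhere. -/

namespace Pseudoknots

/-- The decoration of a double point whose two branches are both monotone in height:
`slash` means that the branch of positive slope `/` passes over, `backslash` means that the branch
of negative slope `\` passes over, and `pre` is a precrossing (no information). -/
inductive Crossing : Type
  | slash
  | backslash
  | pre
  deriving DecidableEq

/-- The decoration read after a quarter turn of the plane. It is also the effect of changing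
the crossing, if it is a classical one. -/
def Crossing.turn : Crossing → Crossing
  | slash => backslash
  | backslash => slash
  | pre => pre

/-- A crossing is classical if its over/under information is given. -/
def Crossing.IsClassical (c : Crossing) : Prop := c ≠ Crossing.pre

/-- What happens in an elementary slice: a local minimum `∪`, a local maximum `∩`,
or a double point. -/
inductive Kind : Type
  | cup
  | cap
  | cross (c : Crossing)
  deriving DecidableEq

/-- Number of ends at the bottom. -/
def Kind.inn : Kind → ℕ
  | cup => 0
  | cap => 2
  | cross _ => 2

/-- Number of ends at the top. -/
def Kind.out : Kind → ℕ
  | cup => 2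
  | cap => 0
  | cross _ => 2

/-- An elementary slice: the event `kind` together with the number `pos` of vertical strands
to the left of it. Strands are numbered `0, 1, 2, …` from left to right at each level. -/
structure Slice : Type where
  kind : Kind
  pos : ℕ
  deriving DecidableEq

/-- A local minimum creating the strands `i` and `i + 1`. -/
abbrev cup (i : ℕ) : Slice := ⟨Kind.cup, i⟩

/-- A local maximum joining the strands `i` and `i + 1`. -/
abbrev cap (i : ℕ) : Slice := ⟨Kind.cap, i⟩

/-- A double point of the strands `i` and `i + 1`. -/
abbrev cross (c : Crossing) (i : ℕ) : Slice := ⟨Kind.cross c, i⟩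

/-- A stack of slices, the lowest one first. -/
abbrev Word : Type := List Slice

/-- Number of strands above a stack that starts with `n` strands at the bottom; `none` if some
slice does not fit on the strands below it. -/
def strandsAbove : ℕ → Word → Option ℕ
  | n, [] => some n
  | n, s :: w =>
    if s.pos + s.kind.inn ≤ n then strandsAbove (n - s.kind.inn + s.kind.out) w else none

/-- `(t, p)` is a point of the stack `w` (with no strands at the bottom): the strand number `p` at
the level just above the first `t` slices. -/
def IsPoint (w : Word) (x : ℕ × ℕ) : Prop :=
  ∃ n, strandsAbove 0 (w.take x.1) = some n ∧ x.2 < n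

/-- Two points are joined by an arc of the curve inside one slice. At a double point the curve goes
straight on. -/
inductive Joined (w : Word) : ℕ × ℕ → ℕ × ℕ → Prop
  | left (a b : Word) (s : Slice) (p : ℕ) (hw : w = a ++ s :: b) (hp : p < s.pos) :
      Joined w (a.length, p) (a.length + 1, p)
  | right (a b : Word) (s : Slice) (p : ℕ) (hw : w = a ++ s :: b) :
      Joined w (a.length, s.pos + s.kind.inn + p) (a.length + 1, s.pos + s.kind.out + p)
  | cup (a b : Word) (i : ℕ) (hw : w = a ++ cup i :: b) :
      Joined w (a.length + 1, i) (a.length + 1, i + 1)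
  | cap (a b : Word) (i : ℕ) (hw : w = a ++ cap i :: b) :
      Joined w (a.length, i) (a.length, i + 1)
  | slash (a b : Word) (c : Crossing) (i : ℕ) (hw : w = a ++ cross c i :: b) :
      Joined w (a.length, i) (a.length + 1, i + 1)
  | backslash (a b : Word) (c : Crossing) (i : ℕ) (hw : w = a ++ cross c i :: b) :
      Joined w (a.length, i + 1) (a.length + 1, i)

/-- A pseudodiagram of a knot: a stack of slices without ends at the bottom and at the top, whose
underlying curve is non-empty and has exactly one component. -/
structure Pseudodiagram : Type where
  word : Word
  closed : strandsAbove 0 word = some 0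
  nonempty : ∃ x, IsPoint word x
  connected : ∀ x y, IsPoint word x → IsPoint word y → Relation.EqvGen (Joined word) x y

/-- The number of precrossings of a pseudodiagram. -/
def Pseudodiagram.precrossings (D : Pseudodiagram) : ℕ :=
  (D.word.map Slice.kind).count (Kind.cross Crossing.pre)

/-- The elementary planar isotopies between stacks of slices. -/
inductive PlanarIsotopy : Word → Word → Prop
  /-- Two events, the first to the left of the second, exchange their heights. -/
  | exchange (k l : Kind) (i j : ℕ) (hij : i ≤ j) :
      PlanarIsotopy [⟨k, i⟩, ⟨l, j + k.out⟩] [⟨l, j + k.inn⟩, ⟨k, i⟩]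
  /-- A zigzag of one strand is straightened. -/
  | zigzagRight (i : ℕ) : PlanarIsotopy [cup i, cap (i + 1)] []
  | zigzagLeft (i : ℕ) : PlanarIsotopy [cup (i + 1), cap i] []
  /-- A double point moves along an arc over a local maximum. -/
  | overMax (c : Crossing) (i : ℕ) :
      PlanarIsotopy [cross c i, cap (i + 1)] [cross c.turn (i + 1), cap i]
  /-- A double point moves along an arc through a local minimum. -/
  | throughMin (c : Crossing) (i : ℕ) :
      PlanarIsotopy [cup i, cross c (i + 1)] [cup (i + 1), cross c.turn i]

/-- The condition for a third Reidemeister move on strands `x`, `y`, `z` (from left to right at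
the bottom) with double points `xy`, `xz`, `yz`, in each of which the branch of positive slope is
the strand that is named first: one of the three strands passes over both others, or under both
others. The remaining double point is arbitrary. -/
def ThirdMoveAllowed (xy xz yz : Crossing) : Prop :=
  (xy.IsClassical ∧ xz = xy) ∨ (xy.IsClassical ∧ yz = xy.turn) ∨ (xz.IsClassical ∧ yz = xz)

/-- The pseudo-Reidemeister moves. -/
inductive PseudoReidemeister : Word → Word → Prop
  /-- R1 and, for `c = pre`, PR1. -/
  | oneMax (c : Crossing) (i : ℕ) : PseudoReidemeister [cross c i, cap i] [cap i]
  | oneMin (c : Crossing) (i : ℕ) : PseudoReidemeister [cup i, cross c i] [cup i]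
  /-- R2. -/
  | two (c : Crossing) (hc : c.IsClassical) (i : ℕ) :
      PseudoReidemeister [cross c i, cross c.turn i] []
  /-- PR2. -/
  | preTwo (c : Crossing) (hc : c.IsClassical) (i : ℕ) :
      PseudoReidemeister [cross c i, cross Crossing.pre i] [cross Crossing.pre i, cross c i]
  /-- R3 and, if one of the double points is a precrossing, PR3. -/
  | three (xy xz yz : Crossing) (h : ThirdMoveAllowed xy xz yz) (i : ℕ) :
      PseudoReidemeister [cross xy i, cross xz (i + 1), cross yz i]
        [cross yz (i + 1), cross xz i, cross xy (i + 1)]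

/-- A crossing change at a classical crossing. -/
inductive CrossingChange : Word → Word → Prop
  | change (c : Crossing) (hc : c.IsClassical) (i : ℕ) :
      CrossingChange [cross c i] [cross c.turn i]

/-- The pseudodiagrams `D` and `E` differ by replacing some consecutive slices `u` by `v`, where
`u` and `v` are related by `R`. -/
def Local (R : Word → Word → Prop) (D E : Pseudodiagram) : Prop :=
  ∃ a b u v : Word, R u v ∧ D.word = a ++ u ++ b ∧ E.word = a ++ v ++ b

/-- A single planar isotopy or pseudo-Reidemeister move. -/
def Move (D E : Pseudodiagram) : Prop :=
  Local PlanarIsotopy D E ∨ Local PseudoReidemeister D E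

/-- Pseudodiagrams are equivalent if a finite sequence of moves and inverses of moves leads from
one to the other. -/
def equivalence : Setoid Pseudodiagram := Relation.EqvGen.setoid Move

/-- A pseudoknot is an equivalence class of pseudodiagrams. -/
def Pseudoknot : Type := Quotient equivalence

/-- The pseudoknot represented by a pseudodiagram. -/
def Pseudodiagram.pseudoknot (D : Pseudodiagram) : Pseudoknot := Quotient.mk equivalence D

/-- Pseudoknots are homotopic if some pseudodiagrams of them are related by a finite sequence of
crossing changes and moves. -/
def Pseudoknot.Homotopic (K L : Pseudoknot) : Prop :=
  ∃ D E : Pseudodiagram, D.pseudoknot = K ∧ E.pseudoknot = L ∧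
    Relation.EqvGen (fun D' E' => Move D' E' ∨ Local CrossingChange D' E') D E

/-- The points of the round circle. -/
theorem circle_points (x : ℕ × ℕ) (hx : IsPoint [cup 0, cap 0] x) : x = (1, 0) ∨ x = (1, 1) := by
  obtain ⟨t, p⟩ := x
  obtain ⟨n, hn, hp⟩ := hx
  rcases t with _ | _ | t
  · simp [strandsAbove] at hn hp
    omega
  · simp [strandsAbove, Kind.inn, Kind.out] at hn hp
    simp
    omega
  · simp [strandsAbove, Kind.inn, Kind.out] at hn hp
    omega

/-- The round circle, a diagram without double points. -/
def circle : Pseudodiagram where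
  word := [cup 0, cap 0]
  closed := rfl
  nonempty := ⟨(1, 0), 2, rfl, Nat.zero_lt_two⟩
  connected := by
    have h : Relation.EqvGen (Joined [cup 0, cap 0]) (1, 0) (1, 1) :=
      Relation.EqvGen.rel _ _ (Joined.cup [] [cap 0] 0 rfl)
    intro x y hx hy
    rcases circle_points x hx with rfl | rfl <;> rcases circle_points y hy with rfl | rfl
    · exact Relation.EqvGen.refl _
    · exact h
    · exact h.symm
    · exact Relation.EqvGen.refl _

/-- The unknot. -/
def unknot : Pseudoknot := circle.pseudoknot

end Pseudoknots

/-! ### Homotopies of stacks with free ends, and the moves as rewriting rules. -/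

namespace Pseudoknots

/-! Up to crossing changes all classical crossings look alike, so the part of the diagram outside
the precrossing matters only through the way in which it joins the four ends of the precrossing. Of
the three pairings of these ends, one gives a curve with two components; the other two give a circle
with a kink at the precrossing, which PR1 removes.

To make this precise, homotopies are first defined for stacks with free ends and without any
connectedness condition (`Homotopy`). Strands that pass over two others carry the precrossing to the
bottom left (`exists_bouquet`); above it remain four ends and a flat stack, in which every double
point is the standard `swap`. In a flat stack the arc from a given end can be made simple and pushed
to the bottom (`exists_arc`): the slices below its maximum are moved past the arc, absorbed into it,
or straightened by a zigzag. A zigzag removes a local minimum, so the induction is lexicographic in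
the number of minima and the length of the stack. Two applications give the normal form of
`exists_small`, with a pairing `j ≤ 2` and a closed remainder `v`.

Every stack in a sequence of moves must be a knot diagram. This is controlled by colourings with two
colours: a closed curve is connected exactly when no colouring that is constant along it uses both
colours. The relation `Colouring` composes along stacks and is preserved by every elementary change,
so a homotopy that starts at a knot diagram stays among knot diagrams (`Homotopy.eqvGen`).
Colourings also exclude a non-empty `v` (`Pseudodiagram.eq_nil_of_word_eq_append`) and the pairing
`j = 1` (`bouquet_one_ne_word`). PR2 is not needed to simplify the diagram. -/

/-- The local changes that are allowed in a homotopy of pseudodiagrams. -/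
inductive Elementary : Word → Word → Prop
  | isotopy {u v : Word} (h : PlanarIsotopy u v) : Elementary u v
  | reidemeister {u v : Word} (h : PseudoReidemeister u v) : Elementary u v
  | change {u v : Word} (h : CrossingChange u v) : Elementary u v

/-- A local change in a stack above `n` strands. -/
def Step (n : ℕ) (u v : Word) : Prop :=
  ∃ a b x y : Word, ∃ k m : ℕ, Elementary x y ∧ u = a ++ x ++ b ∧ v = a ++ y ++ b ∧
    strandsAbove n a = some k ∧ strandsAbove k x = some m ∧ strandsAbove k y = some m

/-- Homotopy of stacks above `n` strands. -/
def Homotopy (n : ℕ) : Word → Word → Prop := Relation.EqvGen (Step n)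

theorem strandsAbove_append (n : ℕ) (a b : Word) :
    strandsAbove n (a ++ b) = (strandsAbove n a).bind fun k => strandsAbove k b := by
  induction a generalizing n with
  | nil => rfl
  | cons s a ih =>
    simp only [List.cons_append, strandsAbove]
    split_ifs
    · exact ih _
    · rfl

theorem strandsAbove_append_of_eq {n k : ℕ} {a : Word} (h : strandsAbove n a = some k) (b : Word) :
    strandsAbove n (a ++ b) = strandsAbove k b := by
  rw [strandsAbove_append, h]; rfl

theorem strandsAbove_cons {n : ℕ} {s : Slice} (h : s.pos + s.kind.inn ≤ n) (w : Word) :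
    strandsAbove n (s :: w) = strandsAbove (n - s.kind.inn + s.kind.out) w := by
  simp [strandsAbove, h]

theorem strandsAbove_cons_eq_some {n m : ℕ} {s : Slice} {w : Word} :
    strandsAbove n (s :: w) = some m ↔
      s.pos + s.kind.inn ≤ n ∧ strandsAbove (n - s.kind.inn + s.kind.out) w = some m := by
  simp [strandsAbove]

theorem strandsAbove_nil (n : ℕ) : strandsAbove n [] = some n := rfl

namespace Homotopy

variable {n k m : ℕ} {u v w a b : Word}

theorem refl (n : ℕ) (u : Word) : Homotopy n u u := Relation.EqvGen.refl u

theorem symm (h : Homotopy n u v) : Homotopy n v u := Relation.EqvGen.symm _ _ h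

theorem trans (h : Homotopy n u v) (h' : Homotopy n v w) : Homotopy n u w :=
  Relation.EqvGen.trans _ _ _ h h'

theorem of_elementary (h : Elementary u v) (hu : strandsAbove n u = some m)
    (hv : strandsAbove n v = some m) : Homotopy n u v :=
  Relation.EqvGen.rel _ _ ⟨[], [], u, v, n, m, h, by simp, by simp, rfl, hu, hv⟩

theorem append (h : Homotopy n u v) (b : Word) : Homotopy n (u ++ b) (v ++ b) := by
  induction h with
  | rel u v h =>
    obtain ⟨a, b', x, y, k, m, hxy, rfl, rfl, h⟩ := h
    exact Relation.EqvGen.rel _ _ ⟨a, b' ++ b, x, y, k, m, hxy, by simp, by simp, h⟩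
  | refl u => exact refl _ _
  | symm u v _ ih => exact ih.symm
  | trans u v w _ _ ih ih' => exact ih.trans ih'

theorem prepend (ha : strandsAbove n a = some k) (h : Homotopy k u v) :
    Homotopy n (a ++ u) (a ++ v) := by
  induction h with
  | rel u v h =>
    obtain ⟨a', b, x, y, k', m, hxy, rfl, rfl, h1, h⟩ := h
    exact Relation.EqvGen.rel _ _ ⟨a ++ a', b, x, y, k', m, hxy, by simp, by simp,
      by rw [strandsAbove_append_of_eq ha, h1], h⟩
  | refl u => exact refl _ _
  | symm u v _ ih => exact ih.symm
  | trans u v w _ _ ih ih' => exact ih.trans ih'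

theorem cons {s : Slice} (hs : s.pos + s.kind.inn ≤ n)
    (h : Homotopy (n - s.kind.inn + s.kind.out) u v) : Homotopy n (s :: u) (s :: v) :=
  prepend (a := [s]) (by rw [strandsAbove_cons hs]; rfl) h

theorem strandsAbove_eq (h : Homotopy n u v) : strandsAbove n u = strandsAbove n v := by
  induction h with
  | rel u v h =>
    obtain ⟨a, b, x, y, k, m, hxy, rfl, rfl, h1, h2, h3⟩ := h
    simp [strandsAbove_append, h1, h2, h3]
  | refl u => rfl
  | symm u v _ ih => exact ih.symm
  | trans u v w _ _ ih ih' => exact ih.trans ih'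

/-- Two events, the first to the left of the second, exchange their heights. -/
theorem exchange (K L : Kind) {i j : ℕ} (hij : i ≤ j) (hn : j + K.inn + L.inn ≤ n) (b : Word) :
    Homotopy n (⟨K, i⟩ :: ⟨L, j + K.out⟩ :: b) (⟨L, j + K.inn⟩ :: ⟨K, i⟩ :: b) := by
  refine append (u := [_, _]) (v := [_, _]) (of_elementary (m := n - K.inn - L.inn + K.out + L.out)
    (.isotopy (.exchange K L i j hij)) ?_ ?_) b <;>
  · simp only [strandsAbove_cons_eq_some, strandsAbove_nil, Option.some.injEq]
    omega

end Homotopy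

theorem Kind.inn_cross (c : Crossing) : (Kind.cross c).inn = 2 := rfl

/-- The standard classical double point. -/
abbrev swap (i : ℕ) : Slice := cross Crossing.slash i

namespace Homotopy

variable {n : ℕ}

/-- Crossing changes make over and under irrelevant; hence a single classical crossing, `swap`,
suffices from here on. -/
theorem change (c : Crossing) (hc : c.IsClassical) {i : ℕ} (hi : i + 2 ≤ n) (b : Word) :
    Homotopy n (cross c i :: b) (swap i :: b) := by
  cases c with
  | slash => exact refl _ _
  | backslash =>
    refine append (u := [_]) (v := [_])
      (of_elementary (m := n) (.change (.change _ hc i)) ?_ ?_) b <;>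
    · simp only [strandsAbove_cons_eq_some, strandsAbove_nil, Option.some.injEq, Kind.inn,
        Kind.out]
      omega
  | pre => exact absurd rfl hc

theorem swap_swap {i : ℕ} (hi : i + 2 ≤ n) (b : Word) :
    Homotopy n (swap i :: swap i :: b) b := by
  have h : Homotopy n [swap i, cross Crossing.backslash i] [] := by
    refine of_elementary (m := n) (.reidemeister (.two _ (by simp [Crossing.IsClassical]) i)) ?_ ?_
    all_goals
      simp only [strandsAbove_cons_eq_some, strandsAbove_nil, Option.some.injEq, Kind.inn,
        Kind.out]
    omega
  refine trans (cons (s := swap i) hi (symm (change .backslash ?_ ?_ b))) (h.append b)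
  · simp [Crossing.IsClassical]
  · simp only [Kind.inn, Kind.out]; omega

/-- The leftmost strand passes over the other two, so their own double point `c` is arbitrary. With
`c = pre` this is PR3, the move that transports the precrossing. -/
theorem braid {i : ℕ} (hi : i + 3 ≤ n) (c : Crossing) (b : Word) :
    Homotopy n (swap i :: swap (i + 1) :: cross c i :: b)
      (cross c (i + 1) :: swap i :: swap (i + 1) :: b) := by
  refine append (u := [_, _, _]) (v := [_, _, _]) (of_elementary (m := n)
    (.reidemeister (.three .slash .slash c (.inl ⟨by simp [Crossing.IsClassical], rfl⟩) i)) ?_ ?_) b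
  all_goals
    simp only [strandsAbove_cons_eq_some, strandsAbove_nil, Option.some.injEq, Kind.inn, Kind.out]
    omega

theorem zigzag_right {i : ℕ} (hi : i + 1 ≤ n) (b : Word) :
    Homotopy n (cup i :: cap (i + 1) :: b) b := by
  refine append (u := [_, _]) (v := []) (of_elementary (m := n)
    (.isotopy (.zigzagRight i)) ?_ ?_) b
  all_goals
    simp only [strandsAbove_cons_eq_some, strandsAbove_nil, Option.some.injEq, Kind.inn, Kind.out]
  omega

theorem zigzag_left {i : ℕ} (hi : i + 1 ≤ n) (b : Word) :
    Homotopy n (cup (i + 1) :: cap i :: b) b := by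
  refine append (u := [_, _]) (v := []) (of_elementary (m := n)
    (.isotopy (.zigzagLeft i)) ?_ ?_) b
  all_goals
    simp only [strandsAbove_cons_eq_some, strandsAbove_nil, Option.some.injEq, Kind.inn, Kind.out]
  omega

theorem cross_cap (c : Crossing) {i : ℕ} (hi : i + 2 ≤ n) (b : Word) :
    Homotopy n (cross c i :: cap i :: b) (cap i :: b) := by
  refine append (u := [_, _]) (v := [_]) (of_elementary (m := n - 2)
    (.reidemeister (.oneMax c i)) ?_ ?_) b
  all_goals
    simp only [strandsAbove_cons_eq_some, strandsAbove_nil, Option.some.injEq, Kind.inn, Kind.out]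
    omega

theorem cup_cross (c : Crossing) {i : ℕ} (hi : i ≤ n) (b : Word) :
    Homotopy n (cup i :: cross c i :: b) (cup i :: b) := by
  refine append (u := [_, _]) (v := [_]) (of_elementary (m := n + 2)
    (.reidemeister (.oneMin c i)) ?_ ?_) b
  all_goals
    simp only [strandsAbove_cons_eq_some, strandsAbove_nil, Option.some.injEq, Kind.inn, Kind.out]
    omega

theorem over_max (c : Crossing) {i : ℕ} (hi : i + 3 ≤ n) (b : Word) :
    Homotopy n (cross c i :: cap (i + 1) :: b) (cross c.turn (i + 1) :: cap i :: b) := by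
  refine append (u := [_, _]) (v := [_, _]) (of_elementary (m := n - 2)
    (.isotopy (.overMax c i)) ?_ ?_) b
  all_goals
    simp only [strandsAbove_cons_eq_some, strandsAbove_nil, Option.some.injEq, Kind.inn, Kind.out]
    omega

theorem through_min (c : Crossing) {i : ℕ} (hi : i + 1 ≤ n) (b : Word) :
    Homotopy n (cup i :: cross c (i + 1) :: b) (cup (i + 1) :: cross c.turn i :: b) := by
  refine append (u := [_, _]) (v := [_, _]) (of_elementary (m := n + 2)
    (.isotopy (.throughMin c i)) ?_ ?_) b
  all_goals
    simp only [strandsAbove_cons_eq_some, strandsAbove_nil, Option.some.injEq, Kind.inn, Kind.out]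
    omega

/-- The quarter turn of the crossing caused by the isotopy is undone by a crossing change. -/
theorem swap_over_max {i : ℕ} (hi : i + 3 ≤ n) (b : Word) :
    Homotopy n (swap i :: cap (i + 1) :: b) (swap (i + 1) :: cap i :: b) :=
  (over_max .slash hi b).trans (change .backslash (by simp [Crossing.IsClassical]) (by omega) _)

theorem swap_through_min {i : ℕ} (hi : i + 1 ≤ n) (b : Word) :
    Homotopy n (cup i :: swap (i + 1) :: b) (cup (i + 1) :: swap i :: b) :=
  (through_min .slash hi b).trans (cons (by simpa [Kind.inn] using hi)
    (change .backslash (by simp [Crossing.IsClassical]) (by simp only [Kind.inn, Kind.out]; omega) _))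

end Homotopy

/-! ### Flat stacks and strands that move across slices. -/

/-- A slice without a precrossing, in which a double point is the standard classical one. -/
def Kind.IsFlat (K : Kind) : Prop := K = .cup ∨ K = .cap ∨ K = .cross .slash

/-- A stack of slices without precrossings, with standard double points. -/
def IsFlat (w : Word) : Prop := ∀ s ∈ w, s.kind.IsFlat

theorem isFlat_cons {s : Slice} {w : Word} : IsFlat (s :: w) ↔ s.kind.IsFlat ∧ IsFlat w := by
  simp [IsFlat]

theorem isFlat_append {u v : Word} : IsFlat (u ++ v) ↔ IsFlat u ∧ IsFlat v := by
  simp [IsFlat, or_imp, forall_and]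

theorem Kind.IsFlat.cup : Kind.cup.IsFlat := .inl rfl
theorem Kind.IsFlat.cap : Kind.cap.IsFlat := .inr (.inl rfl)
theorem Kind.IsFlat.swap : (Kind.cross .slash).IsFlat := .inr (.inr rfl)

/-- The strand number `a + i` moves to the left across `i` strands. -/
def descend (a : ℕ) : ℕ → Word
  | 0 => []
  | i + 1 => swap (a + i) :: descend a i

/-- The strand number `a` moves to the right across `i` strands. -/
def ascend (a : ℕ) : ℕ → Word
  | 0 => []
  | i + 1 => ascend a i ++ [swap (a + i)]

theorem strandsAbove_descend {n a i : ℕ} (h : a + i + 1 ≤ n) :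
    strandsAbove n (descend a i) = some n := by
  induction i with
  | zero => rfl
  | succ i ih =>
    rw [descend, strandsAbove_cons (by simp only [Kind.inn]; omega)]
    simp only [Kind.inn, Kind.out]
    rw [show n - 2 + 2 = n by omega]
    exact ih (by omega)

theorem strandsAbove_ascend {n a i : ℕ} (h : a + i + 1 ≤ n) :
    strandsAbove n (ascend a i) = some n := by
  induction i with
  | zero => rfl
  | succ i ih =>
    rw [ascend, strandsAbove_append_of_eq (ih (by omega))]
    simp only [strandsAbove_cons_eq_some, strandsAbove_nil, Option.some.injEq, Kind.inn, Kind.out]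
    omega

theorem descend_add (a i j : ℕ) : descend a (i + j) = descend (a + i) j ++ descend a i := by
  induction j with
  | zero => rfl
  | succ j ih => rw [← add_assoc, descend, descend, ih, ← add_assoc]; rfl

theorem isFlat_ascend (a i : ℕ) : IsFlat (ascend a i) := by
  induction i with
  | zero => simp [IsFlat, ascend]
  | succ i ih =>
    rw [ascend, isFlat_append]
    exact ⟨ih, by simpa [IsFlat] using Kind.IsFlat.swap⟩

namespace Homotopy

variable {n : ℕ}

theorem prepend_swap {i : ℕ} (hi : i + 2 ≤ n) {u v : Word} (h : Homotopy n u v) :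
    Homotopy n (swap i :: u) (swap i :: v) :=
  cons hi (by simp only [Kind.inn, Kind.out]; rwa [show n - 2 + 2 = n by omega])

theorem prepend_cup {i : ℕ} (hi : i ≤ n) {u v : Word} (h : Homotopy (n + 2) u v) :
    Homotopy n (cup i :: u) (cup i :: v) :=
  cons hi h

theorem prepend_cap {i : ℕ} (hi : i + 2 ≤ n) {u v : Word} (h : Homotopy (n - 2) u v) :
    Homotopy n (cap i :: u) (cap i :: v) :=
  cons hi h

theorem prepend_descend {a i : ℕ} (hi : a + i + 1 ≤ n) {u v : Word} (h : Homotopy n u v) :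
    Homotopy n (descend a i ++ u) (descend a i ++ v) :=
  prepend (strandsAbove_descend hi) h

/-- A slice to the right of a descending strand. -/
theorem descend_left (K : Kind) {a i k : ℕ} (hk : a + i + 1 ≤ k) (hn : k + K.inn ≤ n) (b : Word) :
    Homotopy n (⟨K, k⟩ :: (descend a i ++ b)) (descend a i ++ ⟨K, k⟩ :: b) := by
  induction i with
  | zero => exact refl _ _
  | succ i ih =>
    refine trans ?_ (prepend_swap (by omega) (ih (by omega)))
    obtain ⟨j, rfl⟩ : ∃ j, k = j + 2 := ⟨k - 2, by omega⟩
    exact (exchange (.cross .slash) K (j := j) (by omega) (by rw [Kind.inn_cross]; omega) _).symm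

/-- A strand to the right of a slice passes to its left. -/
theorem descend_across_min {K : Kind} (hK : K.IsFlat) {p : ℕ} (hn : p + K.inn + 1 ≤ n) (b : Word) :
    Homotopy n (⟨K, p⟩ :: (descend p K.out ++ b)) (descend p K.inn ++ ⟨K, p + 1⟩ :: b) := by
  rcases hK with rfl | rfl | rfl
  · simp only [Kind.inn] at hn
    exact (swap_through_min (by omega) _).trans (prepend_cup (by omega) (swap_swap (by omega) b))
  · simp only [Kind.inn] at hn
    exact ((prepend_swap (by omega) (swap_over_max (by omega) b)).trans
      (swap_swap (by omega) _)).symm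
  · simp only [Kind.inn] at hn
    exact braid (by omega) .slash b

/-- The moving strand meets three groups of strands: those to the right of the event, whose
crossings merely exchange heights with it; the ends of the event, treated by `descend_across_min`;
and those to the left, above which the event can be lifted by `descend_left`. -/
theorem descend_across {K : Kind} (hK : K.IsFlat) {a k i : ℕ} (hk : k ≤ i)
    (hn : a + i + K.inn + 1 ≤ n) (b : Word) :
    Homotopy n (⟨K, a + k⟩ :: (descend a (i + K.out) ++ b))
      (descend a (i + K.inn) ++ ⟨K, a + k + 1⟩ :: b) := by
  induction i, hk using Nat.le_induction with
  | base =>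
    rw [descend_add, descend_add, List.append_assoc, List.append_assoc]
    refine (descend_across_min hK (by omega) _).trans ?_
    refine prepend (strandsAbove_descend (by omega)) ?_
    exact descend_left K (by omega) (by omega) b
  | succ i hi ih =>
    rw [show i + 1 + K.out = (i + K.out) + 1 by omega, show i + 1 + K.inn = (i + K.inn) + 1 by omega]
    simp only [descend, List.cons_append]
    refine trans ?_ (prepend_swap (by omega) (ih (by omega)))
    rw [← add_assoc, ← add_assoc]
    exact exchange K (.cross .slash) (by omega) (by rw [Kind.inn_cross]; omega) _

/-- A descending strand that starts at a local minimum turns around it. -/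
theorem cup_descend {a k : ℕ} (hn : a + k ≤ n) (b : Word) :
    Homotopy n (cup (a + k) :: (descend a k ++ b)) (cup a :: (ascend (a + 1) k ++ b)) := by
  induction k generalizing b with
  | zero => exact refl _ _
  | succ k ih =>
    refine (swap_through_min (i := a + k) (by omega) _).symm.trans ?_
    refine (prepend_cup (by omega) (descend_left (.cross .slash) (a := a) (i := k) (by omega)
      (by simp only [Kind.inn]; omega) b)).trans ?_
    refine (ih (by omega) _).trans ?_
    rw [ascend, List.append_assoc, show a + 1 + k = a + k + 1 by omega]
    exact refl _ _

theorem ascend_cap {i : ℕ} (hn : i + 3 ≤ n) (b : Word) :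
    Homotopy n (ascend 2 i ++ cap 0 :: b) (cap 0 :: (ascend 0 i ++ b)) := by
  induction i generalizing b with
  | zero => exact refl _ _
  | succ i ih =>
    rw [ascend, ascend, List.append_assoc, List.append_assoc]
    refine trans ?_ (ih (by omega) _)
    refine prepend (strandsAbove_ascend (by omega)) ?_
    rw [show 2 + i = i + 2 by omega, zero_add]
    exact (exchange .cap (.cross .slash) (i := 0) (j := i) (by omega)
      (by simp only [Kind.inn]; omega) _).symm

/-- A local maximum is pulled like a finger across the strands to its left; each strand then crosses
both legs. -/
theorem cap_eq_descend {k : ℕ} (hn : k + 2 ≤ n) (b : Word) :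
    Homotopy n (cap k :: b) (descend 0 k ++ descend 1 k ++ cap 0 :: b) := by
  induction k with
  | zero => exact refl _ _
  | succ k ih =>
    simp only [descend, List.cons_append, zero_add, List.append_assoc]
    refine trans ?_ (prepend_swap (by omega)
      (descend_left (.cross .slash) (a := 0) (i := k) (by omega) (by simp only [Kind.inn]; omega) _))
    rw [show 1 + k = k + 1 by omega]
    refine trans ?_ (prepend_swap (by omega) (prepend_swap (by omega) (by
      simpa only [List.append_assoc] using ih (by omega))))
    exact ((prepend_swap (by omega) (swap_over_max (by omega) b).symm).trans
      (swap_swap (by omega) _)).symm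

end Homotopy

/-! ### Making an arc simple. -/

/-- A precrossing with all its ends at the top, in front of `b`. -/
def bouquet (b : Word) : Word :=
  cup 0 :: cup 1 :: cross Crossing.pre 0 :: b

/-- The number of local minima. -/
def cups (w : Word) : ℕ := (w.map Slice.kind).count Kind.cup

theorem cups_cons (s : Slice) (w : Word) :
    cups (s :: w) = cups w + if s.kind = Kind.cup then 1 else 0 := by
  simp [cups, List.count_cons]

theorem cups_append (u v : Word) : cups (u ++ v) = cups u + cups v := by
  simp [cups]

theorem cups_ascend (a i : ℕ) : cups (ascend a i) = 0 := by
  induction i with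
  | zero => rfl
  | succ i ih => rw [ascend, cups_append, ih]; rfl

namespace Homotopy

variable {n : ℕ}

theorem slice_cap_zero (K : Kind) {p : ℕ} (hn : p + 2 + K.inn ≤ n) (b : Word) :
    Homotopy n (⟨K, p + 2⟩ :: cap 0 :: b) (cap 0 :: ⟨K, p⟩ :: b) :=
  (exchange .cap K (i := 0) (j := p) (by omega) hn b).symm

/-- A slice to the right of the leftmost strand is absorbed into the arc that starts there, or
straightened. -/
theorem absorb_slice {K : Kind} (hK : K.IsFlat) {p j : ℕ} (hp : 1 ≤ p) (hn : p + K.inn ≤ n)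
    (hj : j + 2 ≤ n - K.inn + K.out) {w : Word} (hw : IsFlat w) :
    (∃ j' w', j' + 2 ≤ n ∧ IsFlat w' ∧ cups w' ≤ cups (⟨K, p⟩ :: w) ∧
      Homotopy n (⟨K, p⟩ :: (descend 1 j ++ cap 0 :: w)) (descend 1 j' ++ cap 0 :: w')) ∨
    ∃ v, IsFlat v ∧ cups v < cups (⟨K, p⟩ :: w) ∧
      Homotopy n (⟨K, p⟩ :: (descend 1 j ++ cap 0 :: w)) v := by
  have hleft : 1 + j + 1 ≤ p → j + 2 ≤ n → ∃ j' w', j' + 2 ≤ n ∧ IsFlat w' ∧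
      cups w' ≤ cups (⟨K, p⟩ :: w) ∧
      Homotopy n (⟨K, p⟩ :: (descend 1 j ++ cap 0 :: w)) (descend 1 j' ++ cap 0 :: w') := by
    intro h1 h2
    obtain ⟨q, rfl⟩ : ∃ q, p = q + 2 := ⟨p - 2, by omega⟩
    refine ⟨j, ⟨K, q⟩ :: w, by omega, isFlat_cons.2 ⟨hK, hw⟩, by simp [cups_cons], ?_⟩
    exact (descend_left K h1 hn _).trans
      (prepend_descend (by omega) (slice_cap_zero K hn w))
  have hright : ∀ i, p ≤ 1 + i → i + K.inn + 2 ≤ n → j = i + K.out → ∃ j' w', j' + 2 ≤ n ∧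
      IsFlat w' ∧ cups w' ≤ cups (⟨K, p⟩ :: w) ∧
      Homotopy n (⟨K, p⟩ :: (descend 1 j ++ cap 0 :: w)) (descend 1 j' ++ cap 0 :: w') := by
    rintro i h1 h2 rfl
    obtain ⟨q, rfl⟩ : ∃ q, p = 1 + q := ⟨p - 1, by omega⟩
    refine ⟨i + K.inn, ⟨K, q⟩ :: w, by omega, isFlat_cons.2 ⟨hK, hw⟩, by simp [cups_cons], ?_⟩
    refine (descend_across hK (a := 1) (k := q) (i := i) (by omega) (by omega) _).trans
      (prepend_descend (by omega) ?_)
    rw [show 1 + q + 1 = q + 2 by omega]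
    exact slice_cap_zero K (by omega) w
  rcases hK with rfl | rfl | rfl
  · simp only [Kind.inn, Kind.out] at hn hj hright
    rcases lt_trichotomy p j with h | h | h
    · exact .inl (hright (j - 2) (by omega) (by omega) (by omega))
    -- The right leg of the minimum continues the arc, whose first crossing is therefore a kink at
    -- this minimum. R1 removes it and leaves the left leg as the end of the arc.
    · right
      obtain ⟨q, rfl⟩ : ∃ q, p = 1 + q := ⟨p - 1, by omega⟩
      obtain rfl : j = q + 1 := by omega
      refine ⟨ascend 0 q ++ w, isFlat_append.2 ⟨isFlat_ascend _ _, hw⟩,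
        by simp [cups_cons, cups_append, cups_ascend], ?_⟩
      refine (cup_cross .slash (by omega) _).trans ((cup_descend (by omega) _).trans ?_)
      exact (prepend_cup (by omega) (ascend_cap (by omega) w)).trans (zigzag_left (by omega) _)
    · rcases eq_or_ne p (1 + j) with rfl | h'
      -- The left leg continues the arc. After the descent is turned around the minimum and the
      -- ascending strand is lifted above the maximum, `cup 1` lies directly below `cap 0`, and this
      -- zigzag is straightened.
      · right
        refine ⟨ascend 0 j ++ w, isFlat_append.2 ⟨isFlat_ascend _ _, hw⟩,
          by simp [cups_cons, cups_append, cups_ascend], ?_⟩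
        refine (cup_descend (by omega) _).trans ?_
        exact (prepend_cup (by omega) (ascend_cap (by omega) w)).trans (zigzag_left (by omega) _)
      · exact .inl (hleft (by omega) (by omega))
  · simp only [Kind.inn, Kind.out] at hn hj hright
    rcases le_or_gt p (1 + j) with h | h
    · exact .inl (hright j (by omega) (by omega) (by omega))
    · exact .inl (hleft (by omega) (by omega))
  · simp only [Kind.inn, Kind.out] at hn hj hright
    left
    rcases lt_trichotomy p j with h | h | h
    · exact hright (j - 2) (by omega) (by omega) (by omega)
    -- The slice is the inverse of the first crossing of the arc; R2 cancels both. In the remaining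
    -- adjacent case `p = 1 + j` the slice simply prolongs the descent.
    · obtain ⟨q, rfl⟩ : ∃ q, p = 1 + q := ⟨p - 1, by omega⟩
      obtain rfl : j = q + 1 := by omega
      exact ⟨q, w, by omega, hw, by simp [cups_cons], swap_swap (by omega) _⟩
    · rcases eq_or_ne p (1 + j) with rfl | h'
      · exact ⟨j + 1, w, by omega, hw, by simp [cups_cons], refl _ _⟩
      · exact hleft (by omega) (by omega)

/-- In a flat stack without ends at the top the arc that starts at the strand number `i` can be
made simple and moved to the bottom. -/
theorem exists_arc (c : ℕ) (w : Word) (hc : cups w ≤ c) (hw : IsFlat w) {i : ℕ}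
    (hn : strandsAbove n w = some 0) (hi : i < n) :
    ∃ j w', j + 2 ≤ n ∧ IsFlat w' ∧ cups w' ≤ cups w ∧
      Homotopy n w (descend 0 i ++ (descend 1 j ++ cap 0 :: w')) := by
  induction c using Nat.strong_induction_on generalizing w n i with
  -- The bound `c` stays fixed while the inner induction shortens the stack; it drops only when a
  -- zigzag has removed a minimum.
  | _ c ihc =>
  induction w generalizing n i with
  | nil => simp [strandsAbove] at hn; omega
  | cons s v ih =>
    -- Here the slice has been pushed above the strand that starts at `i`, which is now leftmost,
    -- and it remains to pass the returning end. If this straightens a zigzag, the arc is searched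
    -- again from strand `0` in a stack with fewer minima.
    have hstep : ∀ (K : Kind) (p j : ℕ) (v' : Word), K.IsFlat → 1 ≤ p → p + K.inn ≤ n →
        j + 2 ≤ n - K.inn + K.out → IsFlat v' →
        Homotopy n (s :: v) (descend 0 i ++ ⟨K, p⟩ :: (descend 1 j ++ cap 0 :: v')) →
        cups (⟨K, p⟩ :: v') ≤ cups (s :: v) →
        ∃ j w', j + 2 ≤ n ∧ IsFlat w' ∧ cups w' ≤ cups (s :: v) ∧
          Homotopy n (s :: v) (descend 0 i ++ (descend 1 j ++ cap 0 :: w')) := by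
      intro K p j v' hK hp hpn hj hv' h hcups
      rcases absorb_slice hK hp hpn hj hv' with ⟨j', w', h1, h2, h3, h4⟩ | ⟨u, h2, h3, h4⟩
      · exact ⟨j', w', h1, h2, h3.trans hcups, h.trans (prepend_descend (by omega) h4)⟩
      · have h5 := h.trans (prepend_descend (by omega) h4)
        have h6 : strandsAbove n u = some 0 := by
          rw [← hn, h5.strandsAbove_eq, strandsAbove_append_of_eq (strandsAbove_descend (by omega))]
        obtain ⟨j', w', h7, h8, h9, h10⟩ :=
          ihc (cups u) (by omega) u le_rfl h2 h6 (i := 0) (by omega)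
        exact ⟨j', w', h7, h8, by omega, h5.trans (prepend_descend (by omega) h10)⟩
    obtain ⟨K, k⟩ := s
    obtain ⟨hk, hn'⟩ := strandsAbove_cons_eq_some.1 hn
    obtain ⟨hK, hv⟩ := isFlat_cons.1 hw
    simp only at hk hn' hK
    have hcv : cups v ≤ c := by rw [cups_cons] at hc; omega
    have hleft : i + 1 ≤ k → ∃ j w', j + 2 ≤ n ∧ IsFlat w' ∧ cups w' ≤ cups (⟨K, k⟩ :: v) ∧
        Homotopy n (⟨K, k⟩ :: v) (descend 0 i ++ (descend 1 j ++ cap 0 :: w')) := by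
      intro h
      obtain ⟨j, v', h1, h2, h3, h4⟩ := ih hcv hv hn' (i := i) (by omega)
      refine hstep K k j v' hK (by omega) hk h1 h2 ?_ (by simpa [cups_cons] using h3)
      exact (cons hk h4).trans (descend_left K (by omega) hk _)
    have hright : ∀ q, i = q + K.inn → k ≤ q →
        ∃ j w', j + 2 ≤ n ∧ IsFlat w' ∧ cups w' ≤ cups (⟨K, k⟩ :: v) ∧
          Homotopy n (⟨K, k⟩ :: v) (descend 0 i ++ (descend 1 j ++ cap 0 :: w')) := by
      rintro q rfl h
      obtain ⟨j, v', h1, h2, h3, h4⟩ := ih hcv hv hn' (i := q + K.out) (by omega)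
      refine hstep K (k + 1) j v' hK (by omega) (by omega) h1 h2 ?_
        (by simpa [cups_cons] using h3)
      refine (cons hk h4).trans ?_
      simpa only [zero_add] using descend_across hK (a := 0) (k := k) (i := q) h (by omega)
        (descend 1 j ++ cap 0 :: v')
    rcases hK with rfl | rfl | rfl
    · simp only [Kind.inn, Kind.out] at hk hn' hright
      rcases le_or_gt k i with h | h
      · exact hright i rfl h
      · exact hleft (by omega)
    · simp only [Kind.inn, Kind.out] at hk hn' hright
      rcases lt_or_ge i k with h | h
      · exact hleft (by omega)
      · by_cases h' : k + 2 ≤ i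
        · exact hright (i - 2) (by omega) (by omega)
        -- The slice is the maximum of the arc itself. If the arc starts at the right leg, a kink is
        -- inserted by R1 to exchange the two legs.
        · refine ⟨k, v, by omega, hv, by simp [cups_cons], ?_⟩
          have := cap_eq_descend (n := n) (k := k) (by omega) v
          rw [List.append_assoc] at this
          rcases eq_or_ne i k with rfl | h''
          · exact this
          · obtain rfl : i = k + 1 := by omega
            rw [descend, zero_add]
            exact (cross_cap .slash (by omega) _).symm.trans (prepend_swap (by omega) this)
    · simp only [Kind.inn, Kind.out] at hk hn' hright
      rcases lt_or_ge i k with h | h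
      · exact hleft (by omega)
      · by_cases h' : k + 2 ≤ i
        · exact hright (i - 2) (by omega) (by omega)
        · rw [show n - 2 + 2 = n by omega] at hn'
          rcases eq_or_ne i k with rfl | h''
          -- The strand moves one place to the right in this slice, so its descent above begins by
          -- undoing the slice. In the other case, `i = k + 1`, the slice is itself the first
          -- crossing of the descent.
          · obtain ⟨j, v', h1, h2, h3, h4⟩ := ih hcv hv hn' (i := i + 1) (by omega)
            refine ⟨j, v', h1, h2, by simpa [cups_cons] using h3, ?_⟩
            refine (prepend_swap (by omega) h4).trans ?_
            rw [descend, zero_add]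
            exact swap_swap (by omega) _
          · obtain rfl : i = k + 1 := by omega
            obtain ⟨j, v', h1, h2, h3, h4⟩ := ih hcv hv hn' (i := k) (by omega)
            refine ⟨j, v', h1, h2, by simpa [cups_cons] using h3, ?_⟩
            rw [descend, zero_add]
            exact prepend_swap (by omega) h4

/-! ### Moving the precrossing to the bottom, and the normal form. -/

theorem slice_bouquet (K : Kind) {p : ℕ} (hn : p + K.inn ≤ n) (b : Word) :
    Homotopy n (⟨K, p⟩ :: bouquet b) (bouquet (⟨K, p + 4⟩ :: b)) := by
  -- The bouquet has no ends below and lies to the left of everything, so the slice exchanges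
  -- heights with its three events in turn; the shift by four counts its ends.
  refine (exchange .cup K (i := 0) (j := p) (by omega) hn _).symm.trans
    (prepend_cup (by omega) ?_)
  refine (exchange .cup K (i := 1) (j := p + 2) (by omega)
    (show p + 2 + 0 + K.inn ≤ n + 2 by omega) _).symm.trans (prepend_cup (by omega) ?_)
  exact (exchange (.cross .pre) K (i := 0) (j := p + 2) (by omega)
    (by simp only [Kind.inn_cross]; omega) _).symm

theorem bouquet_congr {u v : Word} (h : Homotopy (n + 4) u v) :
    Homotopy n (bouquet u) (bouquet v) := by
  refine prepend_cup (by omega) (prepend_cup (by omega) (cons (by simp [Kind.inn]) ?_))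
  simpa [Kind.inn, Kind.out] using h

/-- The two lower ends of the precrossing are bent around to the right, each by one zigzag. -/
theorem pre_zero (hn : 2 ≤ n) (b : Word) :
    Homotopy n (cross .pre 0 :: b) (bouquet (cap 3 :: cap 2 :: b)) := by
  refine Homotopy.symm ?_
  refine (prepend_cup (by omega) (prepend_cup (by omega) ((exchange (.cross .pre) .cap (i := 0)
    (j := 1) (by omega) (by simp only [Kind.inn]; omega) _).trans
      (prepend_cap (by simp only [Kind.inn]; omega) (exchange (.cross .pre) .cap (i := 0)
        (j := 0) (by omega) (by simp only [Kind.inn]; omega) _))))).trans ?_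
  refine (prepend_cup (by omega) (exchange .cup .cap (i := 1)
    (j := 1) (by omega) (by simp only [Kind.inn]; omega) _)).trans ?_
  exact (zigzag_right (by omega) _).trans (zigzag_right (by omega) _)

theorem exists_bouquet_of_pre {i : ℕ} (hn : i + 2 ≤ n) :
    ∃ u, IsFlat u ∧ Homotopy n [cross .pre i] (bouquet u) := by
  induction i with
  | zero =>
    exact ⟨[cap 3, cap 2], by simp [IsFlat, Kind.IsFlat], pre_zero hn []⟩
  | succ i ih =>
    obtain ⟨u, hu, h⟩ := ih (by omega)
    -- The trivial braid `swap i, swap (i + 1), swap (i + 1), swap i` is inserted above the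
    -- precrossing, and PR3 pulls its first half below. The precrossing thereby moves one place to
    -- the left, and the two lower crossings then pass above the bouquet, shifted by four.
    refine ⟨swap (i + 4) :: swap (i + 5) :: (u ++ [swap (i + 1), swap i]), ?_, ?_⟩
    · rw [isFlat_cons, isFlat_cons, isFlat_append]
      exact ⟨.swap, .swap, hu, by simp [IsFlat, Kind.IsFlat]⟩
    · have h1 : Homotopy n [cross .pre (i + 1)]
          (cross .pre (i + 1) :: swap i :: swap (i + 1) :: swap (i + 1) :: [swap i]) := by
        refine cons (by simp only [Kind.inn]; omega) ?_
        simp only [Kind.inn, Kind.out]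
        exact ((prepend_swap (by omega) (swap_swap (by omega) _)).trans
          (swap_swap (by omega) _)).symm
      refine h1.trans ((braid (by omega) .pre _).symm.trans ?_)
      refine (prepend_swap (by omega) (prepend_swap (by omega) (h.append _))).trans ?_
      refine (prepend_swap (by omega) (slice_bouquet _ (by simp only [Kind.inn]; omega) _)).trans ?_
      exact slice_bouquet _ (by simp only [Kind.inn]; omega) _

end Homotopy

/-- The number of precrossings of a stack. -/
def precrossings (w : Word) : ℕ := (w.map Slice.kind).count (Kind.cross Crossing.pre)

theorem precrossings_cons (s : Slice) (w : Word) :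
    precrossings (s :: w) = precrossings w + if s.kind = Kind.cross Crossing.pre then 1 else 0 := by
  simp [precrossings, List.count_cons]

namespace Homotopy

variable {n : ℕ}

theorem exists_flat_slice {s : Slice} (hs : s.kind ≠ .cross .pre) (hn : s.pos + s.kind.inn ≤ n)
    (b : Word) : ∃ K : Kind, K.IsFlat ∧ K.inn = s.kind.inn ∧ K.out = s.kind.out ∧
      Homotopy n (s :: b) (⟨K, s.pos⟩ :: b) := by
  obtain ⟨K, p⟩ := s
  cases K with
  | cup => exact ⟨_, .cup, rfl, rfl, refl _ _⟩
  | cap => exact ⟨_, .cap, rfl, rfl, refl _ _⟩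
  | cross c => exact ⟨_, .swap, rfl, rfl, change c (fun h => hs (by rw [h])) hn b⟩

theorem exists_flat {w : Word} {m : ℕ} (hw : precrossings w = 0) (hn : strandsAbove n w = some m) :
    ∃ u, IsFlat u ∧ Homotopy n w u := by
  induction w generalizing n with
  | nil => exact ⟨[], by simp [IsFlat], refl _ _⟩
  | cons s w ih =>
    rw [precrossings_cons] at hw
    obtain ⟨hs, hn⟩ := strandsAbove_cons_eq_some.1 hn
    obtain ⟨u, hu, h⟩ := ih (by omega) hn
    obtain ⟨K, hK, -, -, h'⟩ := exists_flat_slice (s := s) (fun h => by simp [h] at hw) hs u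
    exact ⟨_, isFlat_cons.2 ⟨hK, hu⟩, (cons hs h).trans h'⟩

theorem exists_bouquet {w : Word} {m : ℕ} (hw : precrossings w = 1)
    (hn : strandsAbove n w = some m) : ∃ u, IsFlat u ∧ Homotopy n w (bouquet u) := by
  induction w generalizing n with
  | nil => simp [precrossings] at hw
  | cons s w ih =>
    rw [precrossings_cons] at hw
    obtain ⟨hs, hn⟩ := strandsAbove_cons_eq_some.1 hn
    by_cases hpre : s.kind = .cross .pre
    · obtain ⟨u, hu, h⟩ := exists_flat (by simpa [hpre] using hw) hn
      obtain ⟨K, p⟩ := s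
      obtain rfl : K = .cross .pre := hpre
      obtain ⟨v, hv, h'⟩ := exists_bouquet_of_pre (n := n) (i := p) hs
      exact ⟨v ++ u, isFlat_append.2 ⟨hv, hu⟩, (cons hs h).trans (h'.append u)⟩
    · obtain ⟨u, hu, h⟩ := ih (by simpa [hpre] using hw) hn
      obtain ⟨K, hK, hin, -, h'⟩ := exists_flat_slice hpre hs (bouquet u)
      exact ⟨_, isFlat_cons.2 ⟨hK, hu⟩, (cons hs h).trans (h'.trans
        (slice_bouquet K (by omega) u))⟩

/-- A closed stack with one precrossing is homotopic to a small one and further closed curves. -/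
theorem exists_small {w : Word} (hw : precrossings w = 1) (hn : strandsAbove 0 w = some 0) :
    ∃ j v, j ≤ 2 ∧ strandsAbove 0 v = some 0 ∧
      Homotopy 0 w (bouquet (descend 1 j ++ cap 0 :: cap 0 :: v)) := by
  obtain ⟨u, hu, h⟩ := exists_bouquet hw hn
  have hu0 : strandsAbove 4 u = some 0 := by rw [← hn, h.strandsAbove_eq]; rfl
  obtain ⟨j, u', hj, hu', -, h1⟩ := exists_arc _ u le_rfl hu hu0 (i := 0) (by omega)
  have hu0' : strandsAbove 2 u' = some 0 := by
    rw [← hu0, h1.strandsAbove_eq, descend, List.nil_append,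
      strandsAbove_append_of_eq (strandsAbove_descend (by omega))]
    rfl
  obtain ⟨j', v, hj', -, -, h2⟩ := exists_arc _ u' le_rfl hu' hu0' (i := 0) (by omega)
  -- Only two strands are left, so the second arc has no choice of its other end.
  obtain rfl : j' = 0 := by omega
  refine ⟨j, v, by omega, ?_, ?_⟩
  · rw [← hu0', h2.strandsAbove_eq]; rfl
  · exact h.trans (bouquet_congr (h1.trans (prepend_descend (a := 1) (i := j) (by omega)
      (prepend_cap (by omega) h2))))

/-- PR1 at a maximum, then a zigzag. -/
theorem bouquet_zero : Homotopy 0 (bouquet [cap 0, cap 0]) [cup 0, cap 0] := by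
  refine (prepend_cup (by omega) (prepend_cup (by omega) (cross_cap .pre (by omega) _))).trans ?_
  exact prepend_cup (by omega) (zigzag_left (by omega) _)

/-- The two crossings disappear once the maxima are nested. The precrossing then slides through the
inner minimum, which does not affect `pre`, and becomes a kink below a maximum. -/
theorem bouquet_two : Homotopy 0 (bouquet [swap 2, swap 1, cap 0, cap 0]) [cup 0, cap 0] := by
  refine prepend_cup (by omega) ?_
  -- Raising one maximum above the other lets a crossing slide over it and cancel with the second
  -- one.
  have h : Homotopy 4 [swap 2, swap 1, cap 0, cap 0] [cap 1, cap 0] :=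
    (prepend_swap (by omega) ((prepend_swap (by omega)
      (exchange .cap .cap (i := 0) (j := 0) le_rfl (by simp [Kind.inn]) [])).trans
        (swap_over_max (by omega) _))).trans (swap_swap (by omega) _)
  refine (prepend_cup (by omega) (cons (by simp [Kind.inn]) h)).trans ?_
  refine (through_min .pre (i := 0) (by omega) _).symm.trans ?_
  refine (prepend_cup (by omega) (cross_cap .pre (by omega) _)).trans ?_
  exact zigzag_right (by omega) _

end Homotopy
-- Colourings, as an invariant that detects connectedness.
/-- The strand above a local minimum (or below a local maximum) between the strands `i` and
`i + 1` that continues the strand `p` on its other side. -/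
def skip (i p : ℕ) : ℕ := if p < i then p else p + 2

/-- The strand above a double point of the strands `i` and `i + 1` that continues the strand `p`. -/
def transpose (i p : ℕ) : ℕ := if p = i then i + 1 else if p = i + 1 then i else p

/-- Colours `f` of the strands below a slice and `g` above it agree along the curve. -/
def Passes : Slice → (ℕ → Bool) → (ℕ → Bool) → Prop
  | ⟨.cup, i⟩, f, g => (∀ p, f p = g (skip i p)) ∧ g i = g (i + 1)
  | ⟨.cap, i⟩, f, g => (∀ p, g p = f (skip i p)) ∧ f i = f (i + 1)
  | ⟨.cross _, i⟩, f, g => ∀ p, g p = f (transpose i p)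

/-- The colours of the first `n` strands. -/
def palette (n : ℕ) (f : ℕ → Bool) : Set Bool := {x | ∃ p < n, f p = x}

/-- The stack `w` above `n` strands has a colouring of its arcs with the colours `f` at the bottom
and `g` at the top, in which the colours in `S` occur. -/
def Colouring : ℕ → (ℕ → Bool) → Word → (ℕ → Bool) → Set Bool → Prop
  | n, f, [], g, S => f = g ∧ S = palette n f
  | n, f, s :: w, g, S => ∃ h T, Passes s f h ∧
      Colouring (n - s.kind.inn + s.kind.out) h w g T ∧ S = palette n f ∪ T

theorem palette_subset_of_colouring {n : ℕ} {f g : ℕ → Bool} {w : Word} {S : Set Bool}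
    (h : Colouring n f w g S) : palette n f ⊆ S := by
  cases w with
  | nil => exact h.2.ge
  | cons s w => obtain ⟨_, T, -, -, rfl⟩ := h; exact Set.subset_union_left

/-- Gluing along the middle level makes the relation local, so its invariance need only be checked
on the two sides of each elementary change. -/
theorem colouring_append {n k : ℕ} {f g : ℕ → Bool} {a b : Word} {S : Set Bool}
    (ha : strandsAbove n a = some k) :
    Colouring n f (a ++ b) g S ↔
      ∃ h T U, Colouring n f a h T ∧ Colouring k h b g U ∧ S = T ∪ U := by
  induction a generalizing n f S with
  | nil =>
    obtain rfl : n = k := by simpa [strandsAbove] using ha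
    constructor
    · intro h
      exact ⟨f, _, S, ⟨rfl, rfl⟩, h,
        (Set.union_eq_self_of_subset_left (palette_subset_of_colouring h)).symm⟩
    · rintro ⟨h, T, U, ⟨rfl, rfl⟩, hb, rfl⟩
      rwa [Set.union_eq_self_of_subset_left (palette_subset_of_colouring hb)]
  | cons s a ih =>
    have ha' := (strandsAbove_cons_eq_some.1 ha).2
    simp only [List.cons_append, Colouring, ih ha']
    constructor
    · rintro ⟨h, _, hs, ⟨h', T, U, h1, h2, rfl⟩, rfl⟩
      exact ⟨h', _, U, ⟨h, T, hs, h1, rfl⟩, h2, by rw [Set.union_assoc]⟩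
    · rintro ⟨h', _, U, ⟨h, T, hs, h1, rfl⟩, h2, rfl⟩
      exact ⟨h, _, hs, ⟨h', T, U, h1, h2, rfl⟩, by rw [Set.union_assoc]⟩

theorem colouring_one {n : ℕ} {f g : ℕ → Bool} {s : Slice} {S : Set Bool} :
    Colouring n f [s] g S ↔ Passes s f g ∧
      S = palette n f ∪ palette (n - s.kind.inn + s.kind.out) g := by
  simp only [Colouring]
  constructor
  · rintro ⟨h, T, h1, ⟨rfl, rfl⟩, rfl⟩; exact ⟨h1, rfl⟩
  · rintro ⟨h, rfl⟩; exact ⟨g, _, h, ⟨rfl, rfl⟩, rfl⟩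

/-- Every colour that occurs in `w` occurs at one of its ends. -/
def ColoursAtEnds (n m : ℕ) (w : Word) : Prop :=
  ∀ f g S, Colouring n f w g S → S = palette n f ∪ palette m g

/-- The colours at the ends of `u` and `v` correspond. -/
def SameColourings (n : ℕ) (u v : Word) : Prop :=
  ∀ f g, (∃ S, Colouring n f u g S) ↔ ∃ S, Colouring n f v g S

/-- If no colour is hidden inside, the set of colours is determined by the ends. Invariance then
splits into the correspondence of end colours and the absence of hidden colours, the latter
excluding closed components created or lost by a move. -/
theorem colouring_iff {n m : ℕ} {u v : Word} (h : SameColourings n u v) (hu : ColoursAtEnds n m u)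
    (hv : ColoursAtEnds n m v) (f g : ℕ → Bool) (S : Set Bool) :
    Colouring n f u g S ↔ Colouring n f v g S := by
  constructor <;> intro H
  · obtain ⟨T, hT⟩ := (h f g).1 ⟨S, H⟩
    rwa [hu _ _ _ H, ← hv _ _ _ hT]
  · obtain ⟨T, hT⟩ := (h f g).2 ⟨S, H⟩
    rwa [hv _ _ _ H, ← hu _ _ _ hT]

theorem exists_colouring_nil {n : ℕ} {f g : ℕ → Bool} :
    (∃ S, Colouring n f [] g S) ↔ f = g := by
  simp [Colouring]

theorem exists_colouring_cons {n : ℕ} {f g : ℕ → Bool} {s : Slice} {w : Word} :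
    (∃ S, Colouring n f (s :: w) g S) ↔
      ∃ h, Passes s f h ∧ ∃ S, Colouring (n - s.kind.inn + s.kind.out) h w g S := by
  simp only [Colouring]
  constructor
  · rintro ⟨_, h, T, h1, h2, rfl⟩; exact ⟨h, h1, T, h2⟩
  · rintro ⟨h, h1, T, h2⟩; exact ⟨_, h, T, h1, h2, rfl⟩

theorem coloursAtEnds_nil (n : ℕ) : ColoursAtEnds n n [] := by
  rintro f g S ⟨rfl, rfl⟩
  simp

theorem coloursAtEnds_one {n m : ℕ} {s : Slice} (hm : n - s.kind.inn + s.kind.out = m) :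
    ColoursAtEnds n m [s] := by
  intro f g S h
  rw [(colouring_one.1 h).2, hm]

theorem coloursAtEnds_cons {n m k : ℕ} {s : Slice} {w : Word} (hk : n - s.kind.inn + s.kind.out = k)
    (hw : ColoursAtEnds k m w)
    (h : ∀ f h g, Passes s f h → (∃ S, Colouring k h w g S) →
      palette k h ⊆ palette n f ∪ palette m g) : ColoursAtEnds n m (s :: w) := by
  rintro f g S ⟨f', T, h1, h2, rfl⟩
  rw [hk] at h2
  have h3 := h f f' g h1 ⟨_, h2⟩
  rw [hw _ _ _ h2]
  ext x
  have := @h3 x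
  simp only [Set.mem_union] at this ⊢
  tauto

theorem palette_cross_subset {n : ℕ} {c : Crossing} {i : ℕ} {f g : ℕ → Bool} (hi : i + 2 ≤ n)
    (h : Passes (cross c i) f g) : palette n g ⊆ palette n f := by
  rintro x ⟨p, hp, rfl⟩
  refine ⟨transpose i p, ?_, (h p).symm⟩
  unfold transpose
  split_ifs <;> omega

theorem palette_cross_subset' {n : ℕ} {c : Crossing} {i : ℕ} {f g : ℕ → Bool} (hi : i + 2 ≤ n)
    (h : Passes (cross c i) f g) : palette n f ⊆ palette n g := by
  rintro x ⟨p, hp, rfl⟩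
  refine ⟨transpose i p, ?_, ?_⟩
  · unfold transpose
    split_ifs <;> omega
  · rw [h]
    congr 1
    unfold transpose
    split_ifs <;> omega

/-- A stack that starts with a double point. -/
theorem coloursAtEnds_cross {n m : ℕ} {c : Crossing} {i : ℕ} {w : Word} (hi : i + 2 ≤ n)
    (hw : ColoursAtEnds n m w) : ColoursAtEnds n m (cross c i :: w) :=
  coloursAtEnds_cons (by simp only [Kind.inn, Kind.out]; omega) hw fun _ _ _ h _ =>
    (palette_cross_subset hi h).trans Set.subset_union_left

/-- A double point above a local minimum. -/
theorem coloursAtEnds_cup_cross {n : ℕ} {c : Crossing} {i j : ℕ} (hj : j ≤ n) :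
    ColoursAtEnds n (n + 2) [cup i, cross c j] := by
  refine coloursAtEnds_cons (k := n + 2) rfl (coloursAtEnds_one ?_) fun f h g _ h' => ?_
  · simp [Kind.inn, Kind.out]
  · obtain ⟨S, h'⟩ := h'
    exact (palette_cross_subset' (by omega) (colouring_one.1 h').1).trans Set.subset_union_right

/-- The condition on the colours of the strands that end in the event of a slice. -/
def Kind.Inner : Kind → (ℕ → Bool) → (ℕ → Bool) → ℕ → Prop
  | .cup, _, g, i => g i = g (i + 1)
  | .cap, f, _, i => f i = f (i + 1)
  | .cross _, f, g, i => f i = g (i + 1) ∧ f (i + 1) = g i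

/-- A description uniform in the kind of event, needed for exchanging two arbitrary events. -/
theorem passes_iff {s : Slice} {f g : ℕ → Bool} : Passes s f g ↔ (∀ p < s.pos, f p = g p) ∧
    (∀ p, f (s.pos + s.kind.inn + p) = g (s.pos + s.kind.out + p)) ∧ s.kind.Inner f g s.pos := by
  obtain ⟨K, i⟩ := s
  rcases K with _ | _ | c <;> simp only [Passes, Kind.Inner, Kind.inn, Kind.out]
  · refine ⟨fun ⟨h1, h2⟩ => ⟨fun p hp => ?_, fun p => ?_, h2⟩,
      fun ⟨h1, h2, h3⟩ => ⟨fun p => ?_, h3⟩⟩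
    · rw [h1, skip, if_pos hp]
    · rw [h1, skip, if_neg (by omega)]; congr 1; omega
    · rcases lt_or_ge p i with h | h
      · rw [skip, if_pos h, h1 p h]
      · obtain ⟨q, rfl⟩ := Nat.exists_eq_add_of_le h
        rw [skip, if_neg (by omega), ← add_zero i, h2]; congr 1; omega
  · refine ⟨fun ⟨h1, h2⟩ => ⟨fun p hp => ?_, fun p => ?_, h2⟩,
      fun ⟨h1, h2, h3⟩ => ⟨fun p => ?_, h3⟩⟩
    · rw [h1, skip, if_pos hp]
    · rw [h1, skip, if_neg (by omega)]; congr 1; omega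
    · rcases lt_or_ge p i with h | h
      · rw [skip, if_pos h, h1 p h]
      · obtain ⟨q, rfl⟩ := Nat.exists_eq_add_of_le h
        rw [skip, if_neg (by omega), ← add_zero i, ← h2]; congr 1; omega
  · refine ⟨fun h => ⟨fun p hp => ?_, fun p => ?_, ?_, ?_⟩, fun ⟨h1, h2, h3, h4⟩ p => ?_⟩
    · rw [h, transpose, if_neg (by omega), if_neg (by omega)]
    · rw [h, transpose, if_neg (by omega), if_neg (by omega)]
    · rw [h, transpose, if_neg (by omega), if_pos rfl]
    · rw [h, transpose, if_pos rfl]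
    · unfold transpose
      split_ifs with h5 h6
      · rw [h5, h4]
      · rw [h6, h3]
      · rcases lt_or_ge p i with h | h
        · exact (h1 p h).symm
        · obtain ⟨q, rfl⟩ : ∃ q, p = i + 2 + q := ⟨p - (i + 2), by omega⟩
          exact (h2 q).symm

theorem Kind.Inner.congr {K : Kind} {f g f' g' : ℕ → Bool} {i i' : ℕ} (h : K.Inner f g i)
    (hf : ∀ p < K.inn, f (i + p) = f' (i' + p)) (hg : ∀ p < K.out, g (i + p) = g' (i' + p)) :
    K.Inner f' g' i' := by
  rcases K with _ | _ | c <;> simp only [Kind.Inner, Kind.inn, Kind.out] at h hf hg ⊢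
  · rw [← hg 1 (by omega), ← h]; exact (hg 0 (by omega)).symm
  · rw [← hf 1 (by omega), ← h]; exact (hf 0 (by omega)).symm
  · rw [← hf 1 (by omega), ← hg 1 (by omega), ← h.1, h.2]
    exact ⟨(hf 0 (by omega)).symm, hg 0 (by omega)⟩

theorem exchange_colouring {k l : Kind} {i j n : ℕ} (hij : i ≤ j) :
    SameColourings n [⟨k, i⟩, ⟨l, j + k.out⟩] [⟨l, j + k.inn⟩, ⟨k, i⟩] := by
  intro f g
  simp only [exists_colouring_cons, exists_colouring_nil, exists_eq_right, passes_iff]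
  constructor
  · rintro ⟨h, ⟨h1, h2, h3⟩, h4, h5, h6⟩
    -- In the new middle level the strands to the left of the event `l` are as at the bottom, and
    -- all others are as at the top, up to the change of numbering caused by the event `k`.
    refine ⟨fun p => if p < j + k.inn then f p else g (p - k.inn + k.out), ⟨?_, ?_, ?_⟩, ?_, ?_, ?_⟩
    · intro p hp; simp only [if_pos hp]
    · intro p
      beta_reduce
      rw [if_neg (by omega)]
      have := h2 (j + l.inn + p - i)
      rw [show j + k.inn + l.inn + p = i + k.inn + (j + l.inn + p - i) by omega, this,
        show i + k.out + (j + l.inn + p - i) = j + k.out + l.inn + p by omega, h5]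
      congr 1; omega
    · refine h6.congr (fun p hp => ?_) (fun p hp => ?_)
      · have := h2 (j + p - i)
        rw [show j + k.inn + p = i + k.inn + (j + p - i) by omega, this]
        congr 1; omega
      · rw [if_neg (by omega)]; congr 1; omega
    · intro p hp
      beta_reduce
      rw [if_pos (by omega), h1 p hp, h4 p (by omega)]
    · intro p
      beta_reduce
      split_ifs with hp
      · rw [h2, h4 _ (by omega)]
      · congr 1; omega
    · refine h3.congr (fun p hp => ?_) (fun p hp => ?_)
      · rw [if_pos (by omega)]
      · exact h4 _ (by omega)
  · rintro ⟨h, ⟨h1, h2, h3⟩, h4, h5, h6⟩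
    refine ⟨fun p => if p < j + k.out then g p else f (p - k.out + k.inn), ⟨?_, ?_, ?_⟩, ?_, ?_, ?_⟩
    · intro p hp
      beta_reduce
      rw [if_pos (by omega), h1 p (by omega), h4 p hp]
    · intro p
      simp only
      split_ifs with hp
      · rw [h1 _ (by omega), h5]
      · congr 1; omega
    · refine h6.congr (fun p hp => ?_) (fun p hp => ?_)
      · exact (h1 _ (by omega)).symm
      · rw [if_pos (by omega)]
    · intro p hp
      simp only at hp ⊢
      rw [if_pos hp]
    · intro p
      simp only
      rw [if_neg (by omega), show j + k.out + l.inn + p - k.out + k.inn = j + k.inn + l.inn + p by omega,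
        h2, show j + k.inn + l.out + p = i + k.inn + (j + l.out + p - i) by omega, h5]
      congr 1; omega
    · refine h3.congr (fun p hp => ?_) (fun p hp => ?_)
      · rw [if_neg (by omega)]; congr 1; omega
      · rw [show j + k.inn + p = i + k.inn + (j + p - i) by omega, h5]
        congr 1; omega

theorem coloursAtEnds_exchange {k l : Kind} {i j n : ℕ} (hij : i ≤ j)
    (hn : j + k.inn + l.inn ≤ n) :
    ColoursAtEnds n (n - k.inn + k.out - l.inn + l.out) [⟨k, i⟩, ⟨l, j + k.out⟩] := by
  refine coloursAtEnds_cons rfl (coloursAtEnds_one rfl) ?_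
  rintro f h g h1 ⟨S, h2⟩ x ⟨p, hp, rfl⟩
  obtain ⟨-, h1, -⟩ := passes_iff.1 h1
  obtain ⟨h2, -, -⟩ := passes_iff.1 (colouring_one.1 h2).1
  simp only at h1 h2 hp
  rcases lt_or_ge p (j + k.out) with h3 | h3
  · exact .inr ⟨p, by omega, (h2 p h3).symm⟩
  · refine .inl ⟨p - k.out + k.inn, by omega, ?_⟩
    rw [show p - k.out + k.inn = i + k.inn + (p - i - k.out) by omega, h1]
    congr 1; omega

theorem coloursAtEnds_exchange' {k l : Kind} {i j n : ℕ} (hij : i ≤ j)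
    (hn : j + k.inn + l.inn ≤ n) :
    ColoursAtEnds n (n - k.inn + k.out - l.inn + l.out) [⟨l, j + k.inn⟩, ⟨k, i⟩] := by
  refine coloursAtEnds_cons rfl (coloursAtEnds_one (by simp only; omega)) ?_
  rintro f h g h1 ⟨S, h2⟩ x ⟨p, hp, rfl⟩
  obtain ⟨h1, -, -⟩ := passes_iff.1 h1
  obtain ⟨-, h2, -⟩ := passes_iff.1 (colouring_one.1 h2).1
  simp only at h1 h2 hp
  rcases lt_or_ge p (j + k.inn) with h3 | h3
  · exact .inl ⟨p, by omega, h1 p h3⟩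
  · refine .inr ⟨p - k.inn + k.out, by omega, ?_⟩
    rw [show p - k.inn + k.out = i + k.out + (p - i - k.inn) by omega, ← h2]
    congr 1; omega

theorem exists_colouring_cross {n : ℕ} {f g : ℕ → Bool} {c : Crossing} {i : ℕ} {w : Word} :
    (∃ S, Colouring n f (cross c i :: w) g S) ↔
      ∃ S, Colouring (n - 2 + 2) (fun p => f (transpose i p)) w g S := by
  rw [exists_colouring_cons]
  constructor
  · rintro ⟨h, h1, h2⟩
    obtain rfl : h = fun p => f (transpose i p) := funext h1
    exact h2
  · exact fun h => ⟨_, fun p => rfl, h⟩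

theorem exists_colouring_one {n : ℕ} {f g : ℕ → Bool} {s : Slice} :
    (∃ S, Colouring n f [s] g S) ↔ Passes s f g := by
  simp [exists_colouring_cons, exists_colouring_nil]

theorem zigzag_right_colouring (n i : ℕ) : SameColourings n [cup i, cap (i + 1)] [] := by
  intro f g
  simp only [exists_colouring_cons, exists_colouring_nil, exists_eq_right, Passes]
  constructor
  · rintro ⟨h, ⟨h1, h2⟩, h3, h4⟩
    ext p
    rw [h1, h3]
    rcases eq_or_ne p i with rfl | hp
    · simp only [skip, lt_irrefl, if_false, lt_add_iff_pos_right, zero_lt_one, if_true, h2, h4]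
    · congr 1; unfold skip; split_ifs <;> omega
  · rintro rfl
    -- The three strands `i`, `i + 1`, `i + 2` of the zigzag all get the colour of the straightened
    -- strand `i`.
    refine ⟨fun p => if p ≤ i then f p else if p = i + 1 then f i else f (p - 2), ⟨?_, ?_⟩, ?_, ?_⟩
    · intro p; unfold skip; grind
    · simp
    · intro p; unfold skip; grind
    · simp

theorem zigzag_left_colouring (n i : ℕ) : SameColourings n [cup (i + 1), cap i] [] := by
  intro f g
  simp only [exists_colouring_cons, exists_colouring_nil, exists_eq_right, Passes]
  constructor
  · rintro ⟨h, ⟨h1, h2⟩, h3, h4⟩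
    ext p
    rw [h1, h3]
    rcases eq_or_ne p i with rfl | hp
    · simp only [skip, lt_irrefl, if_false, lt_add_iff_pos_right, zero_lt_one, if_true, h2, h4]
    · congr 1; unfold skip; split_ifs <;> omega
  · rintro rfl
    refine ⟨fun p => if p ≤ i then f p else if p = i + 1 then f i else f (p - 2), ⟨?_, ?_⟩, ?_, ?_⟩
    · intro p; unfold skip; grind
    · simp
    · intro p; unfold skip; grind
    · simp

theorem coloursAtEnds_zigzag_right {n i : ℕ} (hi : i + 1 ≤ n) :
    ColoursAtEnds n n [cup i, cap (i + 1)] := by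
  refine coloursAtEnds_cons (k := n + 2) rfl (coloursAtEnds_one rfl) ?_
  rintro f h g ⟨h1, h2⟩ ⟨S, h3⟩ x ⟨p, hp, rfl⟩
  obtain ⟨h3, h4⟩ := (colouring_one.1 h3).1
  have h5 := h1 i
  rw [skip, if_neg (by omega)] at h5
  by_cases h6 : p = i ∨ p = i + 1 ∨ p = i + 2
  · refine .inl ⟨i, by omega, ?_⟩
    rcases h6 with rfl | rfl | rfl
    · rw [h5, h2, h4]
    · rw [h5, h4]
    · exact h5
  · refine .inl ⟨if p < i then p else p - 2, by split_ifs <;> omega, ?_⟩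
    rw [h1]; congr 1; unfold skip; split_ifs <;> omega

theorem coloursAtEnds_zigzag_left {n i : ℕ} (hi : i + 1 ≤ n) :
    ColoursAtEnds n n [cup (i + 1), cap i] := by
  refine coloursAtEnds_cons (k := n + 2) rfl (coloursAtEnds_one rfl) ?_
  rintro f h g ⟨h1, h2⟩ ⟨S, h3⟩ x ⟨p, hp, rfl⟩
  obtain ⟨h3, h4⟩ := (colouring_one.1 h3).1
  have h5 := h1 i
  rw [skip, if_pos (by omega)] at h5
  by_cases h6 : p = i ∨ p = i + 1 ∨ p = i + 2
  · refine .inl ⟨i, by omega, ?_⟩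
    rcases h6 with rfl | rfl | rfl
    · exact h5
    · rw [h5, h4]
    · rw [h5, h4, h2]
  · refine .inl ⟨if p < i then p else p - 2, by split_ifs <;> omega, ?_⟩
    rw [h1]; congr 1; unfold skip; split_ifs <;> omega

theorem over_max_colouring (c d : Crossing) (n i : ℕ) :
    SameColourings n [cross c i, cap (i + 1)] [cross d (i + 1), cap i] := by
  intro f g
  simp only [exists_colouring_cross, exists_colouring_one, Passes]
  refine and_congr (forall_congr' fun p => ?_) ?_
  · rw [show transpose i (skip (i + 1) p) = transpose (i + 1) (skip i p) by
      unfold transpose skip; split_ifs <;> omega]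
  · simp only [transpose]; grind

theorem exists_colouring_cup_cross {n : ℕ} {f g : ℕ → Bool} {c : Crossing} {i j : ℕ} :
    (∃ S, Colouring n f [cup i, cross c j] g S) ↔
      Passes (cup i) f fun p => g (transpose j p) := by
  have hj : ∀ p, transpose j (transpose j p) = p := by
    intro p; unfold transpose; split_ifs <;> omega
  rw [exists_colouring_cons]
  constructor
  · rintro ⟨h, h1, h2⟩
    convert h1 using 2 with p
    rw [exists_colouring_one] at h2
    rw [h2, hj]
  · intro h
    refine ⟨_, h, ?_⟩
    rw [exists_colouring_one]
    exact fun p => (congrArg g (hj p)).symm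

theorem through_min_colouring (c d : Crossing) (n i : ℕ) :
    SameColourings n [cup i, cross c (i + 1)] [cup (i + 1), cross d i] := by
  intro f g
  simp only [exists_colouring_cup_cross, Passes]
  refine and_congr (forall_congr' fun p => ?_) ?_
  · rw [show transpose (i + 1) (skip i p) = transpose i (skip (i + 1) p) by
      unfold transpose skip; split_ifs <;> omega]
  · simp only [transpose]; grind

theorem one_max_colouring (c : Crossing) {n i : ℕ} :
    SameColourings n [cross c i, cap i] [cap i] := by
  intro f g
  simp only [exists_colouring_cross, exists_colouring_one, Passes]
  refine and_congr (forall_congr' fun p => ?_) ?_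
  · rw [show transpose i (skip i p) = skip i p by
      unfold transpose skip; split_ifs <;> omega]
  · simp only [transpose]; grind

theorem one_min_colouring (c : Crossing) {n i : ℕ} :
    SameColourings n [cup i, cross c i] [cup i] := by
  intro f g
  simp only [exists_colouring_cup_cross, exists_colouring_one, Passes]
  refine and_congr (forall_congr' fun p => ?_) ?_
  · rw [show transpose i (skip i p) = skip i p by
      unfold transpose skip; split_ifs <;> omega]
  · simp only [transpose]; grind

theorem cross_cross_colouring (c d : Crossing) (n i : ℕ) :
    SameColourings n [cross c i, cross d i] [] := by
  intro f g
  simp only [exists_colouring_cross, exists_colouring_nil]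
  rw [show (fun p => f (transpose i (transpose i p))) = f from
    funext fun p => congrArg f (by unfold transpose; split_ifs <;> omega)]

theorem three_colouring (c₁ c₂ c₃ d₁ d₂ d₃ : Crossing) (n i : ℕ) :
    SameColourings n [cross c₁ i, cross c₂ (i + 1), cross c₃ i]
      [cross d₁ (i + 1), cross d₂ i, cross d₃ (i + 1)] := by
  intro f g
  simp only [exists_colouring_cross, exists_colouring_nil]
  have h : ∀ p, transpose i (transpose (i + 1) (transpose i p)) =
      transpose (i + 1) (transpose i (transpose (i + 1) p)) := by
    intro p; simp only [transpose]; grind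
  simp only [h]

theorem cross_colouring (c d : Crossing) (n i : ℕ) :
    SameColourings n [cross c i] [cross d i] := by
  intro f g
  simp only [exists_colouring_cross, exists_colouring_nil]

theorem SameColourings.trans {n : ℕ} {u v w : Word} (h : SameColourings n u v)
    (h' : SameColourings n v w) : SameColourings n u w := fun f g => (h f g).trans (h' f g)

theorem SameColourings.symm {n : ℕ} {u v : Word} (h : SameColourings n u v) :
    SameColourings n v u := fun f g => (h f g).symm

theorem elementary_colouring {u v : Word} (huv : Elementary u v) {n m : ℕ}
    (hu : strandsAbove n u = some m) (hv : strandsAbove n v = some m) (f g : ℕ → Bool)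
    (S : Set Bool) : Colouring n f u g S ↔ Colouring n f v g S := by
  rcases huv with h | h | h
  · rcases h with ⟨k, l, i, j, hij⟩ | i | i | ⟨c, i⟩ | ⟨c, i⟩ <;>
      simp only [strandsAbove_cons_eq_some, strandsAbove_nil, Option.some.injEq] at hu hv
    · obtain rfl : n - k.inn + k.out - l.inn + l.out = m := by omega
      exact colouring_iff (exchange_colouring hij) (coloursAtEnds_exchange hij (by omega))
        (coloursAtEnds_exchange' hij (by omega)) f g S
    · simp only [Kind.inn, Kind.out] at hu
      subst hv
      exact colouring_iff (zigzag_right_colouring n i) (coloursAtEnds_zigzag_right (by omega))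
        (coloursAtEnds_nil n) f g S
    · simp only [Kind.inn, Kind.out] at hu
      subst hv
      exact colouring_iff (zigzag_left_colouring n i) (coloursAtEnds_zigzag_left (by omega))
        (coloursAtEnds_nil n) f g S
    · simp only [Kind.inn, Kind.out] at hu
      have h : ∀ j, ColoursAtEnds n m [cap j] := fun j =>
        coloursAtEnds_one (by simp only [Kind.inn, Kind.out]; omega)
      exact colouring_iff (over_max_colouring _ _ n i) (coloursAtEnds_cross (by omega) (h _))
        (coloursAtEnds_cross (by omega) (h _)) f g S
    · simp only [Kind.inn, Kind.out] at hu
      obtain rfl : m = n + 2 := by omega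
      exact colouring_iff (through_min_colouring _ _ n i) (coloursAtEnds_cup_cross (by omega))
        (coloursAtEnds_cup_cross (by omega)) f g S
  · rcases h with ⟨c, i⟩ | ⟨c, i⟩ | ⟨c, hc, i⟩ | ⟨c, hc, i⟩ | ⟨xy, xz, yz, h, i⟩ <;>
      simp only [strandsAbove_cons_eq_some, strandsAbove_nil, Option.some.injEq, Kind.inn,
        Kind.out] at hu hv
    · have h : ColoursAtEnds n m [cap i] :=
        coloursAtEnds_one (by simp only [Kind.inn, Kind.out]; omega)
      exact colouring_iff (one_max_colouring c) (coloursAtEnds_cross (by omega) h) h f g S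
    · obtain rfl : m = n + 2 := by omega
      exact colouring_iff (one_min_colouring c) (coloursAtEnds_cup_cross (by omega))
        (coloursAtEnds_one rfl) f g S
    · subst hv
      exact colouring_iff (cross_cross_colouring _ _ n i)
        (coloursAtEnds_cross (by omega) (coloursAtEnds_cross (by omega) (coloursAtEnds_nil n)))
        (coloursAtEnds_nil n) f g S
    · obtain rfl : m = n := by omega
      have h : ∀ c d, ColoursAtEnds m m [cross c i, cross d i] := fun c d =>
        coloursAtEnds_cross (by omega) (coloursAtEnds_cross (by omega) (coloursAtEnds_nil m))
      -- For colours only the underlying permutation counts, and both sides of PR2 are trivial as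
      -- permutations.
      exact colouring_iff ((cross_cross_colouring _ _ m i).trans
        (cross_cross_colouring _ _ m i).symm) (h _ _) (h _ _) f g S
    · obtain rfl : m = n := by omega
      have h : ∀ (c d e : Crossing) (j k l : ℕ), j + 2 ≤ m → k + 2 ≤ m → l + 2 ≤ m →
          ColoursAtEnds m m [cross c j, cross d k, cross e l] := fun c d e j k l hj hk hl =>
        coloursAtEnds_cross hj (coloursAtEnds_cross hk (coloursAtEnds_cross hl
          (coloursAtEnds_nil m)))
      exact colouring_iff (three_colouring _ _ _ _ _ _ m i)
        (h _ _ _ _ _ _ (by omega) (by omega) (by omega))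
        (h _ _ _ _ _ _ (by omega) (by omega) (by omega)) f g S
  · rcases h with ⟨c, hc, i⟩
    simp only [strandsAbove_cons_eq_some, strandsAbove_nil, Option.some.injEq, Kind.inn,
      Kind.out] at hu hv
    obtain rfl : m = n := by omega
    exact colouring_iff (cross_colouring _ _ m i)
      (coloursAtEnds_cross (by omega) (coloursAtEnds_nil m))
      (coloursAtEnds_cross (by omega) (coloursAtEnds_nil m)) f g S

theorem Homotopy.colouring {n : ℕ} {u v : Word} (huv : Homotopy n u v) (f g : ℕ → Bool)
    (S : Set Bool) : Colouring n f u g S ↔ Colouring n f v g S := by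
  induction huv generalizing S with
  | rel u v h =>
    obtain ⟨a, b, x, y, k, m, hxy, rfl, rfl, h1, h2, h3⟩ := h
    simp only [List.append_assoc, colouring_append h1, colouring_append h2, colouring_append h3,
      elementary_colouring hxy h2 h3]
  | refl u => exact Iff.rfl
  | symm u v _ ih => exact (ih S).symm
  | trans u v w _ _ ih ih' => exact (ih S).trans (ih' S)

/-! ### Colourings and the components of the curve. -/

/-- A colouring in terms of the colours of all points. -/
theorem colouring_iff_exists {n m : ℕ} {w : Word} (hw : strandsAbove n w = some m)
    {S : Set Bool} : (∃ f g, Colouring n f w g S) ↔ ∃ c : ℕ → ℕ → Bool,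
      (∀ a s b, w = a ++ s :: b → Passes s (c a.length) (c (a.length + 1))) ∧
      S = {x | ∃ t p k, t ≤ w.length ∧ strandsAbove n (w.take t) = some k ∧ p < k ∧ c t p = x} := by
  -- Prescribing the colours at the bottom lets the induction attach a slice below.
  have key : ∀ f, (∃ g, Colouring n f w g S) ↔ ∃ c : ℕ → ℕ → Bool, c 0 = f ∧
      (∀ a s b, w = a ++ s :: b → Passes s (c a.length) (c (a.length + 1))) ∧
      S = {x | ∃ t p k, t ≤ w.length ∧ strandsAbove n (w.take t) = some k ∧ p < k ∧
        c t p = x} := by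
    induction w generalizing n S with
    | nil =>
      intro f
      simp only [Colouring, exists_eq_left', List.length_nil, Nat.le_zero]
      constructor
      · rintro rfl
        refine ⟨fun _ => f, rfl, by simp, ?_⟩
        ext x
        simp [palette, strandsAbove]
      · rintro ⟨c, rfl, -, rfl⟩
        ext x
        simp [palette, strandsAbove]
    | cons s w ih =>
      intro f
      obtain ⟨hs, hw'⟩ := strandsAbove_cons_eq_some.1 hw
      have hset : ∀ c : ℕ → ℕ → Bool, {x | ∃ t p k, t ≤ (s :: w).length ∧
          strandsAbove n ((s :: w).take t) = some k ∧ p < k ∧ c t p = x} =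
          palette n (c 0) ∪ {x | ∃ t p k, t ≤ w.length ∧
            strandsAbove (n - s.kind.inn + s.kind.out) (w.take t) = some k ∧ p < k ∧
              c (t + 1) p = x} := by
        intro c
        ext x
        constructor
        · rintro ⟨t, p, k, h1, h2, h3, h4⟩
          rcases t with _ | t
          · obtain rfl : n = k := by simpa [strandsAbove] using h2
            exact .inl ⟨p, h3, h4⟩
          · rw [List.take_succ_cons, strandsAbove_cons hs] at h2
            exact .inr ⟨t, p, k, by simpa using h1, h2, h3, h4⟩
        · rintro (⟨p, h3, h4⟩ | ⟨t, p, k, h1, h2, h3, h4⟩)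
          · exact ⟨0, p, n, by omega, rfl, h3, h4⟩
          · refine ⟨t + 1, p, k, by simpa using h1, ?_, h3, h4⟩
            rw [List.take_succ_cons, strandsAbove_cons hs, h2]
      simp only [Colouring]
      constructor
      · rintro ⟨g, h, T, h1, h2, rfl⟩
        obtain ⟨c, rfl, h3, rfl⟩ := (ih hw' h).1 ⟨g, h2⟩
        refine ⟨fun t => t.casesOn f c, rfl, ?_, ?_⟩
        · rintro (_ | ⟨s', a⟩) s'' b hab
          · obtain ⟨rfl, rfl⟩ : s = s'' ∧ w = b := by simpa using hab
            exact h1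
          · obtain ⟨rfl, rfl⟩ : s = s' ∧ w = a ++ s'' :: b := by simpa using hab
            exact h3 a s'' b rfl
        · rw [hset]
          rfl
      · rintro ⟨c, rfl, h1, rfl⟩
        obtain ⟨g, h2⟩ := (ih hw' (c 1)).2 ⟨fun t => c (t + 1), rfl, fun a s' b hab =>
          h1 (s :: a) s' b (by rw [hab]; rfl), rfl⟩
        exact ⟨g, c 1, _, h1 [] s w rfl, h2, hset c⟩
  constructor
  · rintro ⟨f, h⟩
    obtain ⟨c, -, h⟩ := (key f).1 h
    exact ⟨c, h⟩
  · rintro ⟨c, h⟩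
    exact ⟨c 0, (key (c 0)).2 ⟨c, rfl, h⟩⟩

theorem isPoint_iff {w : Word} (hw : strandsAbove 0 w = some 0) {x : ℕ × ℕ} :
    IsPoint w x ↔ ∃ k, x.1 ≤ w.length ∧ strandsAbove 0 (w.take x.1) = some k ∧ x.2 < k := by
  constructor
  · rintro ⟨k, h1, h2⟩
    refine ⟨k, ?_, h1, h2⟩
    by_contra! h
    rw [List.take_of_length_le h.le, hw] at h1
    simp only [Option.some.injEq] at h1
    omega
  · rintro ⟨k, -, h⟩
    exact ⟨k, h⟩

/-- The colours of arcs agree with the colours of the points that they join. -/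
theorem forall_passes_iff {w : Word} {c : ℕ → ℕ → Bool} :
    (∀ a s b, w = a ++ s :: b → Passes s (c a.length) (c (a.length + 1))) ↔
      ∀ x y, Joined w x y → c x.1 x.2 = c y.1 y.2 := by
  constructor
  · intro h x y hxy
    rcases hxy with ⟨a, b, s, p, hw, hp⟩ | ⟨a, b, s, p, hw⟩ | ⟨a, b, i, hw⟩ | ⟨a, b, i, hw⟩ |
      ⟨a, b, c, i, hw⟩ | ⟨a, b, c, i, hw⟩ <;> have h1 := passes_iff.1 (h _ _ _ hw)
    · exact h1.1 p hp
    · exact h1.2.1 p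
    · exact h1.2.2
    · exact h1.2.2
    · exact h1.2.2.1
    · exact h1.2.2.2
  · intro h a s b hw
    refine passes_iff.2 ⟨fun p hp => h _ _ (.left a b s p hw hp), fun p => h _ _ (.right a b s p hw),
      ?_⟩
    obtain ⟨K, i⟩ := s
    rcases K with _ | _ | d
    · exact h _ _ (.cup a b i hw)
    · exact h _ _ (.cap a b i hw)
    · exact ⟨h _ _ (.slash a b d i hw), h _ _ (.backslash a b d i hw)⟩

/-- A colouring is constant on components; conversely the indicator function of the component of `x`
is a colouring, so a point of another component would make both colours occur. -/
theorem connected_iff {w : Word} (hw : strandsAbove 0 w = some 0) :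
    (∀ x y, IsPoint w x → IsPoint w y → Relation.EqvGen (Joined w) x y) ↔
      ∀ f g S, Colouring 0 f w g S → S.Subsingleton := by
  constructor
  · intro h f g S hS
    obtain ⟨c, h1, rfl⟩ := (colouring_iff_exists hw).1 ⟨f, g, hS⟩
    rw [forall_passes_iff] at h1
    have h2 : ∀ x y, Relation.EqvGen (Joined w) x y → c x.1 x.2 = c y.1 y.2 := by
      intro x y hxy
      induction hxy with
      | rel x y h => exact h1 x y h
      | refl x => rfl
      | symm x y _ ih => exact ih.symm
      | trans x y z _ _ ih ih' => exact ih.trans ih'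
    rintro x ⟨t, p, k, h3, h4, h5, rfl⟩ y ⟨t', p', k', h3', h4', h5', rfl⟩
    exact h2 (t, p) (t', p') (h _ _ ⟨k, h4, h5⟩ ⟨k', h4', h5'⟩)
  · classical
    intro h x y hx hy
    have h1 : ∀ y z, Joined w y z → decide (Relation.EqvGen (Joined w) x (y.1, y.2)) =
        decide (Relation.EqvGen (Joined w) x (z.1, z.2)) := by
      intro y z hyz
      rw [decide_eq_decide]
      exact ⟨fun h => .trans _ _ _ h (.rel _ _ hyz), fun h => .trans _ _ _ h (.symm _ _ (.rel _ _ hyz))⟩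
    obtain ⟨f, g, h2⟩ := (colouring_iff_exists hw).2
      ⟨fun t p => decide (Relation.EqvGen (Joined w) x (t, p)), (forall_passes_iff
        (c := fun t p => decide (Relation.EqvGen (Joined w) x (t, p)))).2 h1, rfl⟩
    obtain ⟨k, hk⟩ := (isPoint_iff hw).1 hx
    obtain ⟨l, hl⟩ := (isPoint_iff hw).1 hy
    have h3 := h f g _ h2 ⟨x.1, x.2, k, hk.1, hk.2.1, hk.2.2, rfl⟩
      ⟨y.1, y.2, l, hl.1, hl.2.1, hl.2.2, rfl⟩
    rw [decide_eq_decide] at h3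
    exact h3.1 (.refl _)

theorem nonempty_iff {w : Word} (hw : strandsAbove 0 w = some 0) :
    (∃ x, IsPoint w x) ↔ ∃ f g S, Colouring 0 f w g S ∧ S.Nonempty := by
  constructor
  · rintro ⟨x, hx⟩
    obtain ⟨k, hk⟩ := (isPoint_iff hw).1 hx
    obtain ⟨f, g, h⟩ := (colouring_iff_exists hw).2
      ⟨fun _ _ => true, (forall_passes_iff (c := fun _ _ => true)).2 fun _ _ _ => rfl, rfl⟩
    exact ⟨f, g, _, h, true, x.1, x.2, k, hk.1, hk.2.1, hk.2.2, rfl⟩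
  · rintro ⟨f, g, S, h, x, hx⟩
    obtain ⟨c, -, rfl⟩ := (colouring_iff_exists hw).1 ⟨f, g, h⟩
    obtain ⟨t, p, k, -, h1, h2, -⟩ := hx
    exact ⟨(t, p), k, h1, h2⟩

/-! ### From stacks back to knot diagrams. -/

/-- The condition that a stack is a pseudodiagram. -/
theorem exists_word_eq_iff {w : Word} : (∃ D : Pseudodiagram, D.word = w) ↔
    strandsAbove 0 w = some 0 ∧ (∃ f g S, Colouring 0 f w g S ∧ S.Nonempty) ∧
      ∀ f g S, Colouring 0 f w g S → S.Subsingleton := by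
  constructor
  · rintro ⟨D, rfl⟩
    exact ⟨D.closed, (nonempty_iff D.closed).1 D.nonempty, (connected_iff D.closed).1 D.connected⟩
  · rintro ⟨h1, h2, h3⟩
    exact ⟨⟨w, h1, (nonempty_iff h1).2 h2, (connected_iff h1).2 h3⟩, rfl⟩

theorem Homotopy.exists_word_eq {u v : Word} (h : Homotopy 0 u v) :
    (∃ D : Pseudodiagram, D.word = u) ↔ ∃ D : Pseudodiagram, D.word = v := by
  simp only [exists_word_eq_iff, h.colouring, h.strandsAbove_eq]

theorem Pseudodiagram.ext_word {D E : Pseudodiagram} (h : D.word = E.word) : D = E := by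
  cases D; cases E; cases h; rfl

/-- Transitivity passes through an intermediate stack, which must be a pseudodiagram;
`Homotopy.exists_word_eq` supplies it. -/
theorem Homotopy.eqvGen {u v : Word} (h : Homotopy 0 u v) (D E : Pseudodiagram) (hD : D.word = u)
    (hE : E.word = v) :
    Relation.EqvGen (fun D' E' => Move D' E' ∨ Local CrossingChange D' E') D E := by
  induction h generalizing D E with
  | rel u v h =>
    obtain ⟨a, b, x, y, k, m, hxy, rfl, rfl, h1, h2, h3⟩ := h
    refine .rel _ _ ?_
    rcases hxy with h | h | h
    · exact .inl (.inl ⟨a, b, x, y, h, hD, hE⟩)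
    · exact .inl (.inr ⟨a, b, x, y, h, hD, hE⟩)
    · exact .inr ⟨a, b, x, y, h, hD, hE⟩
  | refl u =>
    obtain rfl := Pseudodiagram.ext_word (hD.trans hE.symm)
    exact .refl _
  | symm u v _ ih => exact .symm _ _ (ih E D hE hD)
  | trans u v w h _ ih ih' =>
    obtain ⟨F, hF⟩ := Homotopy.exists_word_eq h |>.1 ⟨D, hD⟩
    exact .trans _ _ _ (ih D F hD hF) (ih' F E hF hE)

/-- The colouring of the first `n` strands by `x`, extended by `true`. -/
def constantBelow (x : Bool) (n p : ℕ) : Bool := if p < n then x else true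

theorem constantBelow_of_lt (x : Bool) {n p : ℕ} (h : p < n) : constantBelow x n p = x := if_pos h

theorem passes_constantBelow (x : Bool) {n : ℕ} {s : Slice} (hs : s.pos + s.kind.inn ≤ n) :
    Passes s (constantBelow x n) (constantBelow x (n - s.kind.inn + s.kind.out)) := by
  refine passes_iff.2 ⟨fun p hp => ?_, fun p => ?_, ?_⟩
  · rw [constantBelow_of_lt x (by omega), constantBelow_of_lt x (by omega)]
  · unfold constantBelow
    split_ifs <;> first | rfl | omega
  · obtain ⟨K, i⟩ := s
    rcases K with _ | _ | d
    · change i + 0 ≤ n at hs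
      change constantBelow x (n - 0 + 2) i = constantBelow x (n - 0 + 2) (i + 1)
      rw [constantBelow_of_lt x (by omega), constantBelow_of_lt x (by omega)]
    · change i + 2 ≤ n at hs
      change constantBelow x n i = constantBelow x n (i + 1)
      rw [constantBelow_of_lt x (by omega), constantBelow_of_lt x (by omega)]
    · change i + 2 ≤ n at hs
      change constantBelow x n i = constantBelow x (n - 2 + 2) (i + 1) ∧
        constantBelow x n (i + 1) = constantBelow x (n - 2 + 2) i
      rw [show n - 2 + 2 = n by omega, constantBelow_of_lt x (by omega),
        constantBelow_of_lt x (by omega)]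
      exact ⟨rfl, rfl⟩

theorem exists_constant_colouring (x : Bool) {n m : ℕ} {w : Word} (hw : strandsAbove n w = some m) :
    ∃ S, Colouring n (constantBelow x n) w (constantBelow x m) S := by
  induction w generalizing n with
  | nil =>
    obtain rfl : n = m := by simpa [strandsAbove] using hw
    exact ⟨_, rfl, rfl⟩
  | cons s w ih =>
    obtain ⟨hs, hw⟩ := strandsAbove_cons_eq_some.1 hw
    obtain ⟨T, hT⟩ := ih hw
    exact ⟨_, _, T, passes_constantBelow x hs, hT, rfl⟩

theorem exists_constant_colouring_of_ne_nil (x : Bool) {w : Word} (hw : strandsAbove 0 w = some 0)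
    (hne : w ≠ []) : ∃ S, Colouring 0 (fun _ => true) w (fun _ => true) S ∧ x ∈ S := by
  -- With no strands only the default colour `true` is left, whatever `x` is; this allows
  -- differently coloured closed stacks to be glued.
  have h0 : constantBelow x 0 = fun _ => true := by ext p; simp [constantBelow]
  obtain ⟨s, w, rfl⟩ := List.exists_cons_of_ne_nil hne
  obtain ⟨hs, hw⟩ := strandsAbove_cons_eq_some.1 hw
  obtain ⟨S, hS⟩ := exists_constant_colouring x hw
  rw [← h0]
  have hout : 0 < s.kind.out := by
    obtain ⟨K, i⟩ := s
    rcases K with _ | _ | c <;> simp [Kind.inn, Kind.out] at hs ⊢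
  exact ⟨_, ⟨_, S, passes_constantBelow x hs, hS, rfl⟩, .inr (palette_subset_of_colouring hS
    ⟨0, by omega, constantBelow_of_lt x (by omega)⟩)⟩

/-- A knot diagram is not a disjoint union of two curves. -/
theorem Pseudodiagram.eq_nil_of_word_eq_append {D : Pseudodiagram} {u v : Word}
    (h : D.word = u ++ v) (hu : strandsAbove 0 u = some 0) (hne : u ≠ []) : v = [] := by
  by_contra hv
  have hv0 : strandsAbove 0 v = some 0 := by
    rw [← D.closed, h, strandsAbove_append_of_eq hu]
  obtain ⟨S, hS, h1⟩ := exists_constant_colouring_of_ne_nil true hu hne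
  obtain ⟨T, hT, h2⟩ := exists_constant_colouring_of_ne_nil false hv0 hv
  have h3 := (exists_word_eq_iff.1 ⟨D, h⟩).2.2 _ _ _
    ((colouring_append hu).2 ⟨_, S, T, hS, hT, rfl⟩)
  exact absurd (h3 (.inl h1) (.inr h2)) (by simp)

/-- The pairing `j = 1` joins each of the two nested minima of the bouquet to itself, which gives
two closed curves. -/
theorem bouquet_one_ne_word (D : Pseudodiagram) :
    D.word ≠ bouquet [swap 1, cap 0, cap 0] := by
  intro h
  have h1 := (exists_word_eq_iff.1 ⟨D, h⟩).2.2
  obtain ⟨S, hS, hf, ht⟩ : ∃ S, Colouring 0 (fun _ => true) (bouquet [swap 1, cap 0, cap 0])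
      (fun _ => true) S ∧ false ∈ S ∧ true ∈ S := by
    -- Level by level, the curve through the outer minimum is `false` and everything else is `true`.
    refine ⟨_, ⟨fun p => !(p < 2 : Bool), _, ?_, ⟨fun p => !(p = 0 ∨ p = 3 : Bool), _, ?_,
      ⟨fun p => !(p = 1 ∨ p = 3 : Bool), _, ?_, ⟨fun p => !(p = 2 ∨ p = 3 : Bool), _, ?_,
      ⟨fun p => !(p < 2 : Bool), _, ?_, ⟨_, _, ?_, ⟨rfl, rfl⟩, rfl⟩, rfl⟩, rfl⟩, rfl⟩, rfl⟩, rfl⟩,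
      .inr (.inl ⟨0, by simp [Kind.inn, Kind.out], rfl⟩),
      .inr (.inr (.inl ⟨1, by simp [Kind.inn, Kind.out], rfl⟩))⟩
    all_goals
      simp only [Passes, skip, transpose]
      grind
  exact absurd (h1 _ _ _ hS hf ht) (by simp)

end Pseudoknots

theorem mainTheorem7 (K : Pseudoknots.Pseudoknot)
    (hK : ∃ D : Pseudoknots.Pseudodiagram, D.pseudoknot = K ∧ D.precrossings = 1) :
    K.Homotopic Pseudoknots.unknot := by
  obtain ⟨D, rfl, hD⟩ := hK
  refine ⟨D, Pseudoknots.circle, rfl, rfl, ?_⟩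
  obtain ⟨j, v, hj, hv, h⟩ := Pseudoknots.Homotopy.exists_small hD D.closed
  obtain ⟨E, hE⟩ := h.exists_word_eq.1 ⟨D, rfl⟩
  -- The normal form below `v` is already closed, so `v` would be a further closed curve in the knot
  -- diagram `E`.
  obtain rfl : v = [] := by
    refine E.eq_nil_of_word_eq_append (u := Pseudoknots.bouquet
      (Pseudoknots.descend 1 j ++ [Pseudoknots.cap 0, Pseudoknots.cap 0])) ?_ ?_ ?_
    · rw [hE]; simp [Pseudoknots.bouquet]
    · interval_cases j <;> rfl
    · simp [Pseudoknots.bouquet]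
  refine Pseudoknots.Homotopy.eqvGen ?_ D _ rfl rfl
  interval_cases j
  · exact h.trans Pseudoknots.Homotopy.bouquet_zero
  · exact absurd hE (Pseudoknots.bouquet_one_ne_word E)
  · exact h.trans Pseudoknots.Homotopy.bouquet_two
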